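/- Let $\mathbf{k}$ be a field of characteristic zero, $V$ a finite-dimensional $\mathbf{k}$-vector space with basis $\{e_a\}$, $\xi=\sum_a \xi^a e_a\in V$, and $B_V$ a bilinear form on $V$ (possibly degenerate). Let $\mathcal K(V,B_V)=SV\otimes \mathrm{Cl}(V,B_V)$, where $SV$ is the symmetric algebra and $\mathrm{Cl}(V,B_V)$ is the Clifford algebra with relations $x\cdot x=B_V(x,x)$; it is $\mathbf{Z}_2$-graded with $SV$ even and $1\otimes x$ odd for $x\in V$. Let $d'$ be its odd derivation with $$d'(1\otimes e_a)=e_a\otimes 1-\xi^a(1\otimes 1),\qquad d'(e_a\otimes 1)=0,$$ which satisfies $d'^2=0$. For $p\in SV=\mathbf{k}[e_a]$ let $p(\xi)\in\mathbf{k}$ be the value of $p$ at $e_a=\xi^a$. (1) The cohomology of $(\mathcal K(V,B_V),d')$ is trivial: the unit map $\mathbf{k}\to H(\mathcal K(V,B_V),d')$ is an isomorphism. (2) Let $\mathcal W\subset GL(V)$ be a finite group generated by reflections (elements whose fixed space is a hyperplane), and let $p_1,\dots,p_r\in SV$ be homogeneous, algebraically independent elements that generate the algebra of invariants, $(SV)^{\mathcal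 W}=\mathbf{k}[p_1,\dots,p_r]$. Let $P\subset SV$ be the linear span of the $p_i-p_i(\xi)$, let $\langle S^+P\rangle$ be the ideal of $\mathcal K(V,B_V)$ generated by the elements $(p_i-p_i(\xi))\otimes 1$, and let $B$ be the bilinear form on $P$ given by $$B(p,q)=\sum_{a,b}\frac{\partial p}{\partial e_a}(\xi)\,\frac{\partial q}{\partial e_b}(\xi)\,B_V(e_a,e_b).$$ Then every $p\in P$ has a cochain of transgression, i.e. an odd $C_p\in\mathcal K(V,B_V)$ with $d'C_p=p\otimes 1$. For all $p,q\in P$ and all cochains of transgression $C_p,C_q$ for them, the element $C_pC_q+C_qC_p$ is a cocycle whose class in $H(\mathcal K(V,B_V),d')\cong\mathbf{k}$ is $B(p,q)+B(q,p)$ (that is, $2B(p,q)$ if $B_V$ is symmetric). Moreover there is an isomorphism of algebras $$\mathrm{Cl}(P,B)\;\cong\; H\big(\mathcal K(V,B_V)/\langle S^+P\rangle,\,d'\big)$$ that sends each $p\in P$ to the class of any cochain of transgression $C_p$ for $p$. -/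

import Mathlib

open scoped TensorProduct
open Module

noncomputable section

namespace Transgression

/-! ### Super differential algebras and their cohomology -/

/-- The structure of a `ℤ/2`-graded differential algebra on `A`. The grading is encoded by its
parity automorphism (`1` on even elements, `-1` on odd ones), which over a ring containing `1/2` is
the same as a `ℤ/2`-grading; `d` is an odd derivation of square zero. -/
structure SuperDifferential (k A : Type*) [CommRing k] [Ring A] [Algebra k A] where
  parity : A →ₐ[k] A
  d : A →ₗ[k] A
  parity_parity : ∀ x, parity (parity x) = x
  d_parity : ∀ x, d (parity x) = -parity (d x)
  leibniz : ∀ x y, d (x * y) = d x * y + parity x * d y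
  d_d : ∀ x, d (d x) = 0

namespace SuperDifferential

variable {k A : Type*} [CommRing k] [Ring A] [Algebra k A] (D : SuperDifferential k A)

def IsOdd (x : A) : Prop := D.parity x = -x

lemma d_one : D.d 1 = 0 := by
  have h := D.leibniz 1 1
  simpa using h

/-- The algebra of cocycles, `ker d`. -/
def cocycles : Subalgebra k A where
  carrier := {x | D.d x = 0}
  mul_mem' := by
    intro x y hx hy
    simp only [Set.mem_ofPred_eq] at hx hy ⊢
    rw [D.leibniz, hx, hy, zero_mul, mul_zero, add_zero]
  add_mem' := by
    intro x y hx hy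
    simp only [Set.mem_ofPred_eq] at hx hy ⊢
    rw [map_add, hx, hy, add_zero]
  algebraMap_mem' := by
    intro c
    simp only [Set.mem_ofPred_eq]
    rw [Algebra.algebraMap_eq_smul_one, map_smul, D.d_one, smul_zero]

/-- The ideal of coboundaries, `im d`, in the algebra of cocycles. -/
def coboundaries : Ideal D.cocycles where
  carrier := {x | ∃ y, D.d y = (x : A)}
  zero_mem' := ⟨0, by simp⟩
  add_mem' := by
    rintro x y ⟨a, ha⟩ ⟨b, hb⟩
    exact ⟨a + b, by rw [map_add, ha, hb]; rfl⟩
  smul_mem' := by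
    rintro ⟨z, hz⟩ ⟨x, hx⟩ ⟨y, hy⟩
    replace hz : D.d z = 0 := hz
    refine ⟨D.parity z * y, ?_⟩
    simp only at hy
    rw [D.leibniz, D.d_parity, D.parity_parity, hz, hy]
    simp

instance : D.coboundaries.IsTwoSided where
  mul_mem_of_left := by
    rintro ⟨x, hx⟩ ⟨z, hz⟩ ⟨y, hy⟩
    replace hz : D.d z = 0 := hz
    refine ⟨y * z, ?_⟩
    simp only at hy
    rw [D.leibniz, hz, hy]
    simp

/-- The cohomology algebra `ker d / im d`. -/
abbrev Cohomology : Type _ := D.cocycles ⧸ D.coboundaries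

/-- The cohomology class of a cocycle. -/
abbrev cls (x : A) (hx : x ∈ D.cocycles) : D.Cohomology :=
  Ideal.Quotient.mk D.coboundaries ⟨x, hx⟩

/-- The structure induced on the quotient by a two-sided ideal stable under `d` and the parity. -/
def quotient (I : Ideal A) [I.IsTwoSided] (hd : ∀ x ∈ I, D.d x ∈ I)
    (hp : ∀ x ∈ I, D.parity x ∈ I) : SuperDifferential k (A ⧸ I) where
  parity := Ideal.Quotient.liftₐ I ((Ideal.Quotient.mkₐ k I).comp D.parity)
    (fun x hx => Ideal.Quotient.eq_zero_iff_mem.2 (hp x hx))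
  d :=
    { toFun := Quotient.lift (fun x => Ideal.Quotient.mk I (D.d x)) (by
        intro x y hxy
        have h : x - y ∈ I := (Submodule.quotientRel_def I).1 hxy
        rw [Ideal.Quotient.eq, ← map_sub]
        exact hd _ h)
      map_add' := by
        intro x y
        obtain ⟨x, rfl⟩ := Ideal.Quotient.mk_surjective x
        obtain ⟨y, rfl⟩ := Ideal.Quotient.mk_surjective y
        change Ideal.Quotient.mk I (D.d (x + y)) = _
        rw [map_add, map_add]
        rfl
      map_smul' := by
        intro c x
        obtain ⟨x, rfl⟩ := Ideal.Quotient.mk_surjective x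
        change Ideal.Quotient.mk I (D.d (c • x)) = c • Ideal.Quotient.mk I (D.d x)
        rw [map_smul]
        rfl }
  parity_parity := by
    intro x
    obtain ⟨x, rfl⟩ := Ideal.Quotient.mk_surjective x
    change Ideal.Quotient.mk I (D.parity (D.parity x)) = _
    rw [D.parity_parity]
  d_parity := by
    intro x
    obtain ⟨x, rfl⟩ := Ideal.Quotient.mk_surjective x
    change Ideal.Quotient.mk I (D.d (D.parity x)) = -Ideal.Quotient.mk I (D.parity (D.d x))
    rw [D.d_parity, map_neg]
  leibniz := by
    intro x y
    obtain ⟨x, rfl⟩ := Ideal.Quotient.mk_surjective x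
    obtain ⟨y, rfl⟩ := Ideal.Quotient.mk_surjective y
    change Ideal.Quotient.mk I (D.d (x * y)) =
      Ideal.Quotient.mk I (D.d x) * Ideal.Quotient.mk I y
        + Ideal.Quotient.mk I (D.parity x) * Ideal.Quotient.mk I (D.d y)
    rw [D.leibniz, map_add, map_mul, map_mul]
  d_d := by
    intro x
    obtain ⟨x, rfl⟩ := Ideal.Quotient.mk_surjective x
    change Ideal.Quotient.mk I (D.d (D.d x)) = 0
    rw [D.d_d, map_zero]

end SuperDifferential

/-! ### The symmetric algebra: evaluation, partial derivatives, invariants -/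

section Sym

variable {k V ι : Type*} [Field k] [AddCommGroup V] [Module k V]

/-- Evaluation `p ↦ p(ξ)` of polynomials in the variables `e a` at `ξ = ∑ ξᵃ e a`: the algebra
homomorphism with `e a ↦ ξᵃ`. -/
def evalAt (e : Basis ι k V) (ξ : V) : SymmetricAlgebra k V →ₐ[k] k :=
  SymmetricAlgebra.lift (e.constr k fun a => e.repr ξ a)

/-- The partial derivative `∂/∂(e a)` on `SV = k[e a]`. -/
def partialDeriv (e : Basis ι k V) (a : ι) : SymmetricAlgebra k V →ₗ[k] SymmetricAlgebra k V :=
  (SymmetricAlgebra.equivMvPolynomial e).symm.toLinearMap ∘ₗ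
    (MvPolynomial.pderiv a).toLinearMap ∘ₗ (SymmetricAlgebra.equivMvPolynomial e).toLinearMap

/-- The gradient at `ξ`, the vector `∑ₐ (∂p/∂(e a))(ξ) e a` of `V`. -/
def gradAt [Fintype ι] (e : Basis ι k V) (ξ : V) : SymmetricAlgebra k V →ₗ[k] V :=
  ∑ a, ((evalAt e ξ).toLinearMap ∘ₗ partialDeriv e a).smulRight (e a)

/-- `(p, q) ↦ ∑ₐᵦ (∂p/∂(e a))(ξ) (∂q/∂(e b))(ξ) B_V(e a, e b)`. -/
def gradForm [Fintype ι] (e : Basis ι k V) (ξ : V) (BV : LinearMap.BilinForm k V) :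
    LinearMap.BilinForm k (SymmetricAlgebra k V) :=
  BV.comp (gradAt e ξ) (gradAt e ξ)

/-- An invertible linear map whose fixed space is a hyperplane. (In a finite group over a field of
characteristic zero these are the pseudo-reflections; they include the reflections of order 2.) -/
def IsReflection (g : V ≃ₗ[k] V) : Prop :=
  finrank k (LinearMap.range (g.toLinearMap - LinearMap.id)) = 1

/-- A finite group of linear automorphisms of `V` that is generated by reflections. -/
def IsFiniteReflectionGroup (W : Subgroup (V ≃ₗ[k] V)) : Prop :=
  Finite W ∧ Subgroup.closure {g | g ∈ W ∧ IsReflection g} = W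

/-- The invariants `(SV)^W` for the action by algebra automorphisms extending that on `V`. -/
def invariants (W : Subgroup (V ≃ₗ[k] V)) : Subalgebra k (SymmetricAlgebra k V) :=
  ⨅ g ∈ W, AlgHom.equalizer
    (SymmetricAlgebra.lift (SymmetricAlgebra.ι k V ∘ₗ g.toLinearMap))
    (AlgHom.id k (SymmetricAlgebra k V))

/-- `f` lies in `Sᵐ V`, the span of the `m`-fold products of vectors. -/
def IsHomogeneous (f : SymmetricAlgebra k V) (m : ℕ) : Prop :=
  f ∈ (LinearMap.range (SymmetricAlgebra.ι k V)) ^ m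

/-- The set of the elements `p i - p i (ξ)` of `SV`. -/
def shiftedGens {r : ℕ} (e : Basis ι k V) (ξ : V) (p : Fin r → SymmetricAlgebra k V) :
    Set (SymmetricAlgebra k V) :=
  Set.range fun i => p i - algebraMap k _ (evalAt e ξ (p i))

end Sym

/-! ### The Clifford-deformed Koszul algebra -/

section Koszul

variable {k V ι : Type*} [Field k] [AddCommGroup V] [Module k V]

/-- `Cl(V, B)`, with the relations `x * x = B(x, x)`; for symmetric `B` equivalently
`x * y + y * x = 2 B(x, y)`. -/
abbrev Cl (B : LinearMap.BilinForm k V) : Type _ := CliffordAlgebra B.toQuadraticMap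

/-- `K(V, B_V) = SV ⊗ Cl(V, B_V)`. -/
abbrev KoszulAlgebra (BV : LinearMap.BilinForm k V) : Type _ :=
  SymmetricAlgebra k V ⊗[k] Cl BV

/-- The inclusion `SV → K(V, B_V)`, `f ↦ f ⊗ 1`. -/
abbrev inclS (BV : LinearMap.BilinForm k V) : SymmetricAlgebra k V →ₐ[k] KoszulAlgebra BV :=
  Algebra.TensorProduct.includeLeft

/-- The parity automorphism of `K(V, B_V)`: `SV` is even and vectors in `Cl` are odd. -/
def koszulParity (BV : LinearMap.BilinForm k V) : KoszulAlgebra BV →ₐ[k] KoszulAlgebra BV :=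
  Algebra.TensorProduct.map (AlgHom.id k _) CliffordAlgebra.involute

variable [Fintype ι]

/-- The deformed differential `d' = ∑ₐ (e a - ξᵃ) ⊗ (contraction with the dual vector eᵃ)`. It is
the odd derivation with `d'(1 ⊗ e a) = e a ⊗ 1 - ξᵃ` and `d'(e a ⊗ 1) = 0`, as the lemmas below
show. -/
def koszulD (e : Basis ι k V) (ξ : V) (BV : LinearMap.BilinForm k V) :
    KoszulAlgebra BV →ₗ[k] KoszulAlgebra BV :=
  ∑ a, TensorProduct.map
    (LinearMap.mulLeft k (SymmetricAlgebra.ι k V (e a) - algebraMap k _ (e.repr ξ a)))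
    (CliffordAlgebra.contractLeft (e.coord a))

variable (e : Basis ι k V) (ξ : V) (BV : LinearMap.BilinForm k V)

lemma koszulD_tmul (s : SymmetricAlgebra k V) (x : Cl BV) :
    koszulD e ξ BV (s ⊗ₜ x) =
      ∑ a, ((SymmetricAlgebra.ι k V (e a) - algebraMap k _ (e.repr ξ a)) * s) ⊗ₜ
        CliffordAlgebra.contractLeft (e.coord a) x := by
  simp [koszulD, LinearMap.sum_apply]

lemma koszulD_inclS (s : SymmetricAlgebra k V) : koszulD e ξ BV (inclS BV s) = 0 := by
  simp [koszulD_tmul]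

lemma koszulD_one_tmul_basis (a : ι) :
    koszulD e ξ BV (1 ⊗ₜ CliffordAlgebra.ι _ (e a)) =
      SymmetricAlgebra.ι k V (e a) ⊗ₜ 1 - algebraMap k _ (e.repr ξ a) := by
  classical
  rw [koszulD_tmul, Finset.sum_eq_single a]
  · simp [CliffordAlgebra.contractLeft_ι, TensorProduct.sub_tmul]
  · intro b _ hb
    simp [CliffordAlgebra.contractLeft_ι, Finsupp.single_eq_of_ne hb]
  · simp

lemma contractLeft_mul (Q : QuadraticForm k V) (f : Dual k V) (x y : CliffordAlgebra Q) :
    CliffordAlgebra.contractLeft f (x * y) =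
      CliffordAlgebra.contractLeft f x * y
        + CliffordAlgebra.involute x * CliffordAlgebra.contractLeft f y := by
  induction x using CliffordAlgebra.left_induction with
  | algebraMap r => simp [CliffordAlgebra.contractLeft_algebraMap_mul]
  | add x x' hx hx' => rw [add_mul, map_add, hx, hx', map_add, map_add, add_mul, add_mul]; abel
  | ι_mul x m hx =>
    rw [mul_assoc, CliffordAlgebra.contractLeft_ι_mul, hx, CliffordAlgebra.contractLeft_ι_mul,
      map_mul, CliffordAlgebra.involute_ι, mul_add, sub_mul, smul_mul_assoc]
    noncomm_ring

lemma contractLeft_involute (Q : QuadraticForm k V) (f : Dual k V) (x : CliffordAlgebra Q) :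
    CliffordAlgebra.contractLeft f (CliffordAlgebra.involute x) =
      -CliffordAlgebra.involute (CliffordAlgebra.contractLeft f x) := by
  induction x using CliffordAlgebra.left_induction with
  | algebraMap r => simp
  | add x x' hx hx' => simp only [map_add, hx, hx', neg_add]
  | ι_mul x m hx =>
    rw [map_mul, CliffordAlgebra.involute_ι, neg_mul, map_neg,
      CliffordAlgebra.contractLeft_ι_mul, hx, CliffordAlgebra.contractLeft_ι_mul, map_sub,
      map_mul, CliffordAlgebra.involute_ι, map_smul]
    noncomm_ring

/-- `K(V, B_V)` with its `ℤ/2`-grading and the deformed differential `d'`. -/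
def koszul [CharZero k] : SuperDifferential k (KoszulAlgebra BV) where
  parity := koszulParity BV
  d := koszulD e ξ BV
  parity_parity := by
    intro x
    induction x using TensorProduct.induction_on with
    | zero => simp
    | add x y hx hy => rw [map_add, map_add, hx, hy]
    | tmul s x => simp [koszulParity, CliffordAlgebra.involute_involute]
  d_parity := by
    intro x
    induction x using TensorProduct.induction_on with
    | zero => simp
    | add x y hx hy => rw [map_add, map_add, hx, hy, map_add, map_add, neg_add]
    | tmul s x =>
      simp [koszulParity, koszulD_tmul, contractLeft_involute, TensorProduct.tmul_neg]
  leibniz := by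
    intro x y
    induction x using TensorProduct.induction_on with
    | zero => simp
    | add x x' hx hx' => rw [add_mul, map_add, hx, hx', map_add, map_add, add_mul, add_mul]; abel
    | tmul s x =>
      induction y using TensorProduct.induction_on with
      | zero => simp
      | add y y' hy hy' =>
        rw [mul_add, map_add, hy, hy', map_add, mul_add, mul_add]; abel
      | tmul t y =>
        simp only [koszulParity, Algebra.TensorProduct.tmul_mul_tmul, koszulD_tmul,
          contractLeft_mul, Algebra.TensorProduct.map_tmul, AlgHom.coe_id, id_eq,
          Finset.sum_mul, Finset.mul_sum, TensorProduct.tmul_add, Finset.sum_add_distrib]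
        congr 1
        · exact Finset.sum_congr rfl fun a _ => by rw [mul_assoc]
        · exact Finset.sum_congr rfl fun a _ => by rw [mul_left_comm]
  d_d := by
    intro x
    induction x using TensorProduct.induction_on with
    | zero => simp
    | add x y hx hy => rw [map_add, map_add, hx, hy, add_zero]
    | tmul s x =>
      have key : koszulD e ξ BV (koszulD e ξ BV (s ⊗ₜ x)) =
          -koszulD e ξ BV (koszulD e ξ BV (s ⊗ₜ x)) := by
        simp only [koszulD_tmul, map_sum]
        rw [← Finset.sum_neg_distrib, Finset.sum_comm]
        refine Finset.sum_congr rfl fun a _ => ?_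
        rw [← Finset.sum_neg_distrib]
        refine Finset.sum_congr rfl fun b _ => ?_
        rw [CliffordAlgebra.contractLeft_comm, TensorProduct.tmul_neg, mul_left_comm]
      have h2 : (2 : k) • koszulD e ξ BV (koszulD e ξ BV (s ⊗ₜ x)) = 0 := by
        rw [two_smul]
        nth_rewrite 2 [key]
        exact add_neg_cancel _
      exact (smul_eq_zero.1 h2).resolve_left two_ne_zero

/-- The ideal `⟨S⁺P⟩` of `K(V, B_V)` generated by a set `P` of elements of `SV`. As `SV` is central,
the left ideal generated by `P` is two-sided. -/
def idealOf (P : Set (SymmetricAlgebra k V)) : Ideal (KoszulAlgebra BV) :=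
  Ideal.span (inclS BV '' P)

lemma inclS_comm (f : SymmetricAlgebra k V) (x : KoszulAlgebra BV) :
    inclS BV f * x = x * inclS BV f := by
  induction x using TensorProduct.induction_on with
  | zero => simp
  | add x y hx hy => rw [mul_add, add_mul, hx, hy]
  | tmul s x => simp [mul_comm]

instance (P : Set (SymmetricAlgebra k V)) : (idealOf BV P).IsTwoSided where
  mul_mem_of_left := by
    intro a b ha
    induction ha using Submodule.span_induction with
    | mem x hx =>
      obtain ⟨f, hf, rfl⟩ := hx
      rw [inclS_comm]
      exact Ideal.mul_mem_left _ _ (Ideal.subset_span ⟨f, hf, rfl⟩)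
    | zero => rw [zero_mul]; exact zero_mem _
    | add x y _ _ hx hy => rw [add_mul]; exact add_mem hx hy
    | smul c x _ hx => rw [smul_eq_mul, mul_assoc]; exact Ideal.mul_mem_left _ _ hx

lemma koszulParity_inclS (f : SymmetricAlgebra k V) :
    koszulParity BV (inclS BV f) = inclS BV f := by
  simp [koszulParity]

/-- The differential algebra `(K(V, B_V), d') / ⟨S⁺P⟩`. -/
def koszulQuotient [CharZero k] (P : Set (SymmetricAlgebra k V)) :
    SuperDifferential k (KoszulAlgebra BV ⧸ idealOf BV P) :=
  (koszul e ξ BV).quotient (idealOf BV P)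
    (by
      intro x hx
      induction hx using Submodule.span_induction with
      | mem x hx =>
        obtain ⟨f, hf, rfl⟩ := hx
        have h : (koszul e ξ BV).d (inclS BV f) = 0 := koszulD_inclS e ξ BV f
        rw [h]; exact zero_mem _
      | zero => rw [map_zero]; exact zero_mem _
      | add x y _ _ hx hy => rw [map_add]; exact add_mem hx hy
      | smul c x hx' hx =>
        rw [smul_eq_mul, (koszul e ξ BV).leibniz]
        exact add_mem (Ideal.mul_mem_left _ _ hx') (Ideal.mul_mem_left _ _ hx))
    (by
      intro x hx
      induction hx using Submodule.span_induction with
      | mem x hx =>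
        obtain ⟨f, hf, rfl⟩ := hx
        have h : (koszul e ξ BV).parity (inclS BV f) = inclS BV f := koszulParity_inclS BV f
        rw [h]; exact Ideal.subset_span ⟨f, hf, rfl⟩
      | zero => rw [map_zero]; exact zero_mem _
      | add x y _ _ hx hy => rw [map_add]; exact add_mem hx hy
      | smul c x _ hx =>
        rw [smul_eq_mul, map_mul]
        exact Ideal.mul_mem_left _ _ hx)

end Koszul

end Transgression

end

open Transgression

/-! Triviality of the cohomology. Let h = ∑ (1 ⊗ e_a) ∂/∂e_a. If ξ = 0 and B_V = 0, then d'h + hd'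
multiplies by the total degree in the even and odd generators. In general this holds up to terms of
lower filtration (`d_h_add_h_d_sub_mem`), so in characteristic zero induction along the filtration
writes every cocycle as a scalar plus a coboundary. Evaluation of SV at ξ gives an algebra map K(V,
B_V) → Cl(V, B_V) that kills coboundaries (`koszulEval_d`). Hence 1 is not a coboundary, and the
scalar class of a cocycle can be computed in the Clifford algebra.

Transgression. Writing p − p(ξ) = ∑ f_a (e_a − ξ^a) gives the cochain C = ∑ f_a ⊗ e_a, whose value
at ξ is the gradient of p, as a vector of Cl(V, B_V). Two cochains for the same element differ by an
odd cocycle, which is a coboundary because scalars are even. So every cochain of transgression has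
the gradient as its value, and anticommutators evaluate to B(p, q) + B(q, p).

The quotient. The elements p_i − p_i(ξ) form a regular sequence in SV. They do so in the ring of
invariants, which is a polynomial ring in the p_i; divided differences of reflections and averaging
over the group lift this to SV (`mem_span_of_mul_mem_span`). Freeness over SV carries it to K(V,
B_V). Dividing by a central regular element q = d'C replaces the cohomology H by H ⊕ C H
(`IsCohomologyModel.extend`). Starting from k, after r steps the cohomology has dimension 2^r and is
spanned by products of the C_i. The Clifford relations hold up to coboundaries, so Cl(P, B) maps
onto it; as dim P ≤ r, the dimensions force an isomorphism. -/

noncomputable section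

namespace Transgression

/-! ### Exhaustive filtrations by powers of a generating subspace -/

section Filtration

variable {k A : Type*} [CommRing k] [Ring A] [Algebra k A]

lemma exists_mem_pow_of_adjoin_eq_top {M : Submodule k A} (h1 : 1 ≤ M)
    (hM : Algebra.adjoin k (M : Set A) = ⊤) (x : A) : ∃ n : ℕ, x ∈ M ^ n := by
  have hx : x ∈ Algebra.adjoin k (M : Set A) := hM ▸ Algebra.mem_top
  induction hx using Algebra.adjoin_induction with
  | mem x hx => exact ⟨1, by simpa using hx⟩
  | algebraMap c => exact ⟨0, by rw [pow_zero]; exact Submodule.algebraMap_mem c⟩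
  | add x y _ _ hx hy =>
    obtain ⟨m, hm⟩ := hx
    obtain ⟨n, hn⟩ := hy
    exact ⟨max m n, add_mem (pow_le_pow_right₀ h1 (le_max_left m n) hm)
      (pow_le_pow_right₀ h1 (le_max_right m n) hn)⟩
  | mul x y _ _ hx hy =>
    obtain ⟨m, hm⟩ := hx
    obtain ⟨n, hn⟩ := hy
    exact ⟨m + n, by rw [pow_add]; exact Submodule.mul_mem_mul hm hn⟩

end Filtration

/-! ### The Koszul homotopy argument from generators and commutation rules -/

section Homotopy

/-- A ring generated by even elements `v ⊗ 1` and odd elements `1 ⊗ v` with a Koszul type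
differential `d`, the partial derivatives in the even generators, and the Koszul homotopy `h`. -/
structure KoszulHomotopy (k A V ι : Type*) [CommRing k] [Ring A] [Algebra k A] [Fintype ι] where
  even : V → A
  odd : V → A
  d : A →ₗ[k] A
  h : A →ₗ[k] A
  pderiv : ι → A →ₗ[k] A
  value : V → k
  coord : ι → V → k
  polar : ι → V → k
  d_d : ∀ x, d (d x) = 0
  d_one : d 1 = 0
  h_one : h 1 = 0
  pderiv_one : ∀ a, pderiv a 1 = 0
  d_even : ∀ v x, d (even v * x) = even v * d x
  d_odd : ∀ v x, d (odd v * x) = even v * x - value v • x - odd v * d x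
  pderiv_even : ∀ a v x, pderiv a (even v * x) = coord a v • x + even v * pderiv a x
  pderiv_odd : ∀ a v x, pderiv a (odd v * x) = odd v * pderiv a x
  h_even : ∀ v x, h (even v * x) = odd v * x + even v * h x
  h_odd : ∀ v x, h (odd v * x) = ∑ a, polar a v • pderiv a x - odd v * h x

namespace KoszulHomotopy

variable {k A V ι : Type*} [Field k] [Ring A] [Algebra k A] [Fintype ι]
  (H : KoszulHomotopy k A V ι)

/-- The span of `1` and the generators; its powers filter the algebra. -/
def genSpan : Submodule k A :=
  1 ⊔ Submodule.span k (Set.range H.even ∪ Set.range H.odd)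

lemma one_le_genSpan : 1 ≤ H.genSpan := le_sup_left

lemma even_mem (v : V) : H.even v ∈ H.genSpan :=
  Submodule.mem_sup_right (Submodule.subset_span (Or.inl ⟨v, rfl⟩))

lemma odd_mem (v : V) : H.odd v ∈ H.genSpan :=
  Submodule.mem_sup_right (Submodule.subset_span (Or.inr ⟨v, rfl⟩))

lemma pow_mono {m n : ℕ} (h : m ≤ n) {x : A} (hx : x ∈ H.genSpan ^ m) : x ∈ H.genSpan ^ n :=
  pow_le_pow_right₀ H.one_le_genSpan h hx

lemma map_algebraMap {f : A →ₗ[k] A} (hf : f 1 = 0) (c : k) : f (algebraMap k A c) = 0 := by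
  rw [Algebra.algebraMap_eq_smul_one, map_smul, hf, smul_zero]

/-- Induction along the filtration by the powers of `genSpan`. -/
lemma genSpan_pow_induction {motive : ℕ → A → Prop}
    (algebraMap : ∀ c, motive 0 (algebraMap k _ c))
    (zero : ∀ n, motive n 0)
    (add : ∀ n x y, motive n x → motive n y → motive n (x + y))
    (succ : ∀ n x, x ∈ H.genSpan ^ n → motive n x → motive (n + 1) x)
    (smul : ∀ n (c : k) x, motive n x → motive n (c • x))
    (even : ∀ n v x, x ∈ H.genSpan ^ n → motive n x → motive (n + 1) (H.even v * x))
    (odd : ∀ n v x, x ∈ H.genSpan ^ n → motive n x → motive (n + 1) (H.odd v * x))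
    {n : ℕ} {x : A} (hx : x ∈ H.genSpan ^ n) : motive n x := by
  induction hx using Submodule.pow_induction_on_left' with
  | algebraMap c => exact algebraMap c
  | add x y i _ _ hx hy => exact add i x y hx hy
  | mem_mul m hm i x hx ih =>
    obtain ⟨a, ha, b, hb, rfl⟩ := Submodule.mem_sup.1 hm
    obtain ⟨r, rfl⟩ := Submodule.mem_one.1 ha
    rw [add_mul, ← Algebra.smul_def]
    refine add _ _ _ (smul _ _ _ (succ _ _ hx ih)) ?_
    clear hm
    induction hb using Submodule.span_induction with
    | mem b hb =>
      rcases hb with ⟨v, rfl⟩ | ⟨v, rfl⟩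
      · exact even _ _ _ hx ih
      · exact odd _ _ _ hx ih
    | zero => rw [zero_mul]; exact zero _
    | add b b' _ _ hb hb' =>
      rw [add_mul]
      exact add _ _ _ hb hb'
    | smul c b _ hb =>
      rw [smul_mul_assoc]
      exact smul _ _ _ hb

/-- Multiplication of a term of lower filtration by a generator. -/
lemma mul_mem_pow {n : ℕ} {g y : A} (hg : g ∈ H.genSpan) (hy : y ∈ H.genSpan ^ (n - 1))
    (h0 : n = 0 → y = 0) : g * y ∈ H.genSpan ^ n := by
  rcases n with _ | n
  · rw [h0 rfl, mul_zero]; exact zero_mem _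
  · rw [pow_succ']; exact Submodule.mul_mem_mul hg hy

lemma exists_algebraMap_eq {n : ℕ} {x : A} (hx : x ∈ H.genSpan ^ n) (hn : n = 0) :
    ∃ c, algebraMap k A c = x := by
  subst hn
  rw [pow_zero] at hx
  exact Submodule.mem_one.1 hx

/-- The commutator of `d` with a partial derivative lowers the filtration. -/
lemma d_pderiv_sub_mem (a : ι) {n : ℕ} {x : A} (hx : x ∈ H.genSpan ^ n) :
    H.d (H.pderiv a x) - H.pderiv a (H.d x) ∈ H.genSpan ^ (n - 1) := by
  -- At n = 0 the exponent n - 1 truncates to 0, so membership alone would not survive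
  -- multiplication by a generator; the expression has to vanish outright.
  have hzero : ∀ {n : ℕ} {x : A}, x ∈ H.genSpan ^ n → n = 0 →
      H.d (H.pderiv a x) - H.pderiv a (H.d x) = 0 := by
    intro n x hx hn
    obtain ⟨c, rfl⟩ := H.exists_algebraMap_eq hx hn
    simp [map_algebraMap (H.pderiv_one a), map_algebraMap H.d_one]
  refine H.genSpan_pow_induction (motive := fun n x =>
    H.d (H.pderiv a x) - H.pderiv a (H.d x) ∈ H.genSpan ^ (n - 1)) ?_ ?_ ?_ ?_ ?_ ?_ ?_ hx
  · intro c; simp [map_algebraMap (H.pderiv_one a), map_algebraMap H.d_one]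
  · simp
  · intro n x y hx hy
    simp only [map_add]
    convert add_mem hx hy using 1
    abel
  · intro n x _ hx
    exact H.pow_mono (by omega) hx
  · intro n c x hx
    simp only [map_smul, ← smul_sub]
    exact Submodule.smul_mem _ c hx
  · intro n v x hxn hx
    rw [H.pderiv_even, H.d_even, H.pderiv_even, map_add, H.d_even, map_smul,
      add_sub_add_left_eq_sub, ← mul_sub]
    exact H.mul_mem_pow (H.even_mem v) hx (hzero hxn)
  · intro n v x hxn hx
    have h : H.d (H.pderiv a (H.odd v * x)) - H.pderiv a (H.d (H.odd v * x))
        = -(H.coord a v • x) - H.odd v * (H.d (H.pderiv a x) - H.pderiv a (H.d x)) := by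
      rw [H.pderiv_odd, H.d_odd, H.d_odd, map_sub, map_sub, H.pderiv_even, H.pderiv_odd, map_smul,
        mul_sub]
      abel
    rw [h]
    exact sub_mem (neg_mem (Submodule.smul_mem _ _ hxn))
      (H.mul_mem_pow (H.odd_mem v) hx (hzero hxn))

/-- On the `n`-th step of the filtration, `d h + h d` is multiplication by `n` up to lower
terms. -/
lemma d_h_add_h_d_sub_mem {n : ℕ} {x : A} (hx : x ∈ H.genSpan ^ n) :
    H.d (H.h x) + H.h (H.d x) - (n : k) • x ∈ H.genSpan ^ (n - 1) := by
  have hzero : ∀ {n : ℕ} {x : A}, x ∈ H.genSpan ^ n → n = 0 →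
      H.d (H.h x) + H.h (H.d x) - (n : k) • x = 0 := by
    intro n x hx hn
    obtain ⟨c, rfl⟩ := H.exists_algebraMap_eq hx hn
    simp [map_algebraMap H.h_one, map_algebraMap H.d_one, hn]
  refine H.genSpan_pow_induction (motive := fun n x =>
    H.d (H.h x) + H.h (H.d x) - (n : k) • x ∈ H.genSpan ^ (n - 1)) ?_ ?_ ?_ ?_ ?_ ?_ ?_ hx
  · intro c; simp [map_algebraMap H.h_one, map_algebraMap H.d_one]
  · simp
  · intro n x y hx hy
    simp only [map_add, smul_add]
    convert add_mem hx hy using 1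
    abel
  · intro n x hxn hx
    -- Regarding x as an element of step n + 1 changes the multiple by x itself, which is a lower
    -- term there.
    rw [Nat.cast_succ, add_smul, one_smul, ← sub_sub]
    exact sub_mem (H.pow_mono (by omega) hx) (by simpa using hxn)
  · intro n c x hx
    simp only [map_smul, smul_comm _ c, ← smul_sub, ← smul_add]
    exact Submodule.smul_mem _ c hx
  · intro n v x hxn hx
    have h : H.d (H.h (H.even v * x)) + H.h (H.d (H.even v * x))
          - ((n + 1 : ℕ) : k) • (H.even v * x)
        = H.even v * (H.d (H.h x) + H.h (H.d x) - (n : k) • x) - H.value v • x := by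
      rw [H.h_even, H.d_even, H.h_even, map_add, H.d_even, H.d_odd, Nat.cast_succ, add_smul,
        one_smul, mul_sub, mul_add, mul_smul_comm]
      abel
    rw [h]
    exact sub_mem (H.mul_mem_pow (H.even_mem v) hx (hzero hxn)) (Submodule.smul_mem _ _ hxn)
  · intro n v x hxn hx
    have h : H.d (H.h (H.odd v * x)) + H.h (H.d (H.odd v * x))
          - ((n + 1 : ℕ) : k) • (H.odd v * x)
        = H.odd v * (H.d (H.h x) + H.h (H.d x) - (n : k) • x)
          + ∑ a, H.polar a v • (H.d (H.pderiv a x) - H.pderiv a (H.d x)) := by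
      simp only [smul_sub, Finset.sum_sub_distrib]
      rw [H.h_odd, H.d_odd, map_sub, map_sub, map_sub, H.h_even, H.h_odd, H.d_odd, Nat.cast_succ,
        add_smul, one_smul, mul_sub, mul_add, mul_smul_comm, map_smul]
      simp only [map_sum, map_smul]
      abel
    rw [h]
    exact add_mem (H.mul_mem_pow (H.odd_mem v) hx (hzero hxn))
      (sum_mem fun a _ => Submodule.smul_mem _ _
        (H.pow_mono (Nat.sub_le n 1) (H.d_pderiv_sub_mem a hxn)))

/-- Every cocycle is a scalar up to a coboundary. -/
theorem exists_eq_algebraMap_add_d [CharZero k]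
    (hgen : Algebra.adjoin k (Set.range H.even ∪ Set.range H.odd) = ⊤) {x : A} (hx : H.d x = 0) :
    ∃ c z, x = algebraMap k _ c + H.d z := by
  obtain ⟨n, hn⟩ := exists_mem_pow_of_adjoin_eq_top H.one_le_genSpan
    (top_unique (hgen.symm.trans_le (Algebra.adjoin_mono
      (Submodule.subset_span.trans (SetLike.coe_mono (le_sup_right :
        _ ≤ H.genSpan)))))) x
  induction n generalizing x with
  | zero =>
    obtain ⟨c, rfl⟩ := H.exists_algebraMap_eq hn rfl
    exact ⟨c, 0, by simp⟩
  | succ n ih =>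
    have h := H.d_h_add_h_d_sub_mem hn
    rw [hx, map_zero, add_zero, Nat.add_sub_cancel] at h
    -- For a cocycle x the element d h x − (n + 1) x is a cocycle one step lower. Solving for x
    -- divides by n + 1.
    obtain ⟨c, z, hz⟩ := ih (by rw [map_sub, H.d_d, map_smul, hx]; simp) h
    have h0 : ((n + 1 : ℕ) : k) ≠ 0 := Nat.cast_ne_zero.2 n.succ_ne_zero
    refine ⟨-(((n + 1 : ℕ) : k)⁻¹ * c), ((n + 1 : ℕ) : k)⁻¹ • (H.h x - z), ?_⟩
    rw [sub_eq_iff_eq_add, ← sub_eq_iff_eq_add'] at hz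
    conv_lhs => rw [← inv_smul_smul₀ h0 x, ← hz]
    rw [map_neg, map_mul, ← Algebra.smul_def, map_smul, map_sub,
      ← smul_neg, ← smul_add]
    congr 1
    abel

end KoszulHomotopy

end Homotopy

lemma SuperDifferential.IsOdd.d_mul {k A : Type*} [CommRing k] [Ring A] [Algebra k A]
    {D : SuperDifferential k A} {x : A} (hx : D.IsOdd x) (y : A) :
    D.d (x * y) = D.d x * y - x * D.d y := by
  rw [D.leibniz, hx, neg_mul, ← sub_eq_add_neg]

/-! ### Generators and Clifford relations of `K(V, B_V)` -/

section KoszulGenerators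

variable {k V ι : Type*} [Field k] [AddCommGroup V] [Module k V] (BV : LinearMap.BilinForm k V)

/-- The even generators `v ⊗ 1` of `K(V, B_V)`. -/
def evenGen : V →ₗ[k] KoszulAlgebra BV :=
  (inclS BV).toLinearMap ∘ₗ SymmetricAlgebra.ι k V

/-- The odd generators `1 ⊗ v` of `K(V, B_V)`. -/
def oddGen : V →ₗ[k] KoszulAlgebra BV :=
  (Algebra.TensorProduct.includeRight : Cl BV →ₐ[k] KoszulAlgebra BV).toLinearMap ∘ₗ
    CliffordAlgebra.ι BV.toQuadraticMap

lemma evenGen_apply (v : V) : evenGen BV v = inclS BV (SymmetricAlgebra.ι k V v) := rfl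

lemma oddGen_apply (v : V) : oddGen BV v = 1 ⊗ₜ CliffordAlgebra.ι BV.toQuadraticMap v := rfl

lemma evenGen_mul_comm (v : V) (x : KoszulAlgebra BV) :
    x * evenGen BV v = evenGen BV v * x := (inclS_comm BV _ x).symm

lemma oddGen_mul_add (v w : V) :
    oddGen BV v * oddGen BV w + oddGen BV w * oddGen BV v =
      algebraMap k _ (BV v w + BV w v) := by
  have h : CliffordAlgebra.ι BV.toQuadraticMap v * CliffordAlgebra.ι BV.toQuadraticMap w +
      CliffordAlgebra.ι BV.toQuadraticMap w * CliffordAlgebra.ι BV.toQuadraticMap v =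
      algebraMap k _ (BV v w + BV w v) := by
    rw [CliffordAlgebra.ι_mul_ι_add_swap, LinearMap.BilinMap.polar_toQuadraticMap]
  simp only [oddGen_apply, Algebra.TensorProduct.tmul_mul_tmul, one_mul, ← TensorProduct.tmul_add,
    h]
  rw [Algebra.algebraMap_eq_smul_one, TensorProduct.tmul_smul, Algebra.algebraMap_eq_smul_one]
  rfl

lemma adjoin_evenGen_union_oddGen :
    Algebra.adjoin k (Set.range (evenGen BV) ∪ Set.range (oddGen BV)) = ⊤ := by
  rw [eq_top_iff]
  rintro x -
  set T := Algebra.adjoin k (Set.range (evenGen BV) ∪ Set.range (oddGen BV))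
  have hS : ∀ s : SymmetricAlgebra k V, inclS BV s ∈ T := by
    intro s
    induction s using SymmetricAlgebra.induction with
    | algebraMap c => rw [AlgHom.commutes]; exact T.algebraMap_mem c
    | ι v => exact Algebra.subset_adjoin (Or.inl ⟨v, rfl⟩)
    | mul a b ha hb => rw [map_mul]; exact mul_mem ha hb
    | add a b ha hb => rw [map_add]; exact add_mem ha hb
  have hC : ∀ y : Cl BV,
      (Algebra.TensorProduct.includeRight : Cl BV →ₐ[k] KoszulAlgebra BV) y ∈ T := by
    intro y
    induction y using CliffordAlgebra.induction with
    | algebraMap c => rw [AlgHom.commutes]; exact T.algebraMap_mem c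
    | ι v => exact Algebra.subset_adjoin (Or.inr ⟨v, rfl⟩)
    | mul a b ha hb => rw [map_mul]; exact mul_mem ha hb
    | add a b ha hb => rw [map_add]; exact add_mem ha hb
  induction x using TensorProduct.induction_on with
  | zero => exact zero_mem _
  | add x y hx hy => exact add_mem hx hy
  | tmul s y =>
    have := mul_mem (hS s) (hC y)
    simpa using this

end KoszulGenerators

/-! ### Every cocycle of `K(V, B_V)` is a scalar up to a coboundary -/

section Acyclic

variable {k V ι : Type*} [Field k] [AddCommGroup V] [Module k V]
  (e : Basis ι k V) (ξ : V) (BV : LinearMap.BilinForm k V)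

variable [Fintype ι] in
lemma evalAt_ι (v : V) :
    evalAt e ξ (SymmetricAlgebra.ι k V v) = ∑ a, e.repr v a * e.repr ξ a := by
  rw [evalAt, SymmetricAlgebra.lift_ι_apply, Basis.constr_apply_fintype]
  simp

lemma evalAt_ι_basis (a : ι) : evalAt e ξ (SymmetricAlgebra.ι k V (e a)) = e.repr ξ a := by
  rw [evalAt, SymmetricAlgebra.lift_ι_apply, Basis.constr_basis]

lemma partialDeriv_mul (a : ι) (s t : SymmetricAlgebra k V) :
    partialDeriv e a (s * t) = s * partialDeriv e a t + partialDeriv e a s * t := by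
  simp [partialDeriv, mul_comm]

lemma partialDeriv_algebraMap (a : ι) (c : k) : partialDeriv e a (algebraMap k _ c) = 0 := by
  simp [partialDeriv]

lemma partialDeriv_ι (a : ι) (v : V) :
    partialDeriv e a (SymmetricAlgebra.ι k V v) = algebraMap k _ (e.repr v a) := by
  classical
  have h : (partialDeriv e a) ∘ₗ SymmetricAlgebra.ι k V =
      (Algebra.linearMap k (SymmetricAlgebra k V)) ∘ₗ e.coord a := by
    refine e.ext fun b => ?_
    by_cases hb : b = a
    · subst hb; simp [partialDeriv]
    · simp [partialDeriv, MvPolynomial.pderiv_X, hb, Finsupp.single_eq_of_ne (Ne.symm hb)]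
  exact LinearMap.congr_fun h v

/-- `∂/∂(e a)` acting on the first factor of `K(V, B_V) = SV ⊗ Cl`. -/
def koszulPartial (a : ι) : KoszulAlgebra BV →ₗ[k] KoszulAlgebra BV :=
  TensorProduct.map (partialDeriv e a) LinearMap.id

lemma koszulPartial_one (a : ι) : koszulPartial e BV a 1 = 0 := by
  change TensorProduct.map _ _ (1 ⊗ₜ 1) = _
  rw [TensorProduct.map_tmul, ← map_one (algebraMap k _), partialDeriv_algebraMap,
    TensorProduct.zero_tmul]

lemma koszulPartial_evenGen_mul (a : ι) (v : V) (x : KoszulAlgebra BV) :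
    koszulPartial e BV a (evenGen BV v * x) =
      e.repr v a • x + evenGen BV v * koszulPartial e BV a x := by
  induction x using TensorProduct.induction_on with
  | zero => simp
  | add x y hx hy => rw [mul_add, map_add, hx, hy, map_add, mul_add, smul_add]; abel
  | tmul s y =>
    simp [koszulPartial, evenGen_apply, partialDeriv_mul, partialDeriv_ι, TensorProduct.add_tmul,
      ← Algebra.smul_def, TensorProduct.smul_tmul']
    abel

lemma koszulPartial_oddGen_mul (a : ι) (v : V) (x : KoszulAlgebra BV) :
    koszulPartial e BV a (oddGen BV v * x) = oddGen BV v * koszulPartial e BV a x := by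
  induction x using TensorProduct.induction_on with
  | zero => simp
  | add x y hx hy => rw [mul_add, map_add, hx, hy, map_add, mul_add]
  | tmul s y => simp [koszulPartial, oddGen_apply]

variable [Fintype ι]

/-- The contracting homotopy `∑ₐ (1 ⊗ e a) ∂/∂(e a)`, up to the grading operator. -/
def koszulHomotopy : KoszulAlgebra BV →ₗ[k] KoszulAlgebra BV :=
  ∑ a, LinearMap.mulLeft k (oddGen BV (e a)) ∘ₗ koszulPartial e BV a

lemma koszulHomotopy_apply (x : KoszulAlgebra BV) :
    koszulHomotopy e BV x = ∑ a, oddGen BV (e a) * koszulPartial e BV a x := by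
  simp [koszulHomotopy]

lemma koszulHomotopy_one : koszulHomotopy e BV 1 = 0 := by
  simp [koszulHomotopy_apply, koszulPartial_one]

lemma koszulHomotopy_evenGen_mul (v : V) (x : KoszulAlgebra BV) :
    koszulHomotopy e BV (evenGen BV v * x) =
      oddGen BV v * x + evenGen BV v * koszulHomotopy e BV x := by
  have hv : oddGen BV v = ∑ a, e.repr v a • oddGen BV (e a) := by
    conv_lhs => rw [← e.sum_repr v, map_sum]
    exact Finset.sum_congr rfl fun a _ => map_smul _ _ _
  simp only [koszulHomotopy_apply, koszulPartial_evenGen_mul, mul_add, Finset.sum_add_distrib]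
  congr 1
  · rw [hv, Finset.sum_mul]
    exact Finset.sum_congr rfl fun a _ => by rw [mul_smul_comm, smul_mul_assoc]
  · rw [Finset.mul_sum]
    exact Finset.sum_congr rfl fun a _ => by
      rw [← mul_assoc, evenGen_mul_comm, mul_assoc]

lemma koszulHomotopy_oddGen_mul (v : V) (x : KoszulAlgebra BV) :
    koszulHomotopy e BV (oddGen BV v * x) =
      ∑ a, (BV (e a) v + BV v (e a)) • koszulPartial e BV a x
        - oddGen BV v * koszulHomotopy e BV x := by
  simp only [koszulHomotopy_apply, koszulPartial_oddGen_mul, Finset.mul_sum]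
  rw [← Finset.sum_sub_distrib]
  refine Finset.sum_congr rfl fun a _ => ?_
  rw [eq_sub_iff_add_eq, ← mul_assoc, ← mul_assoc, ← add_mul, oddGen_mul_add]
  exact (Algebra.smul_def _ _).symm

variable [CharZero k]

lemma koszul_d_inclS (s : SymmetricAlgebra k V) : (koszul e ξ BV).d (inclS BV s) = 0 :=
  koszulD_inclS e ξ BV s

lemma koszul_parity_inclS (s : SymmetricAlgebra k V) :
    (koszul e ξ BV).parity (inclS BV s) = inclS BV s :=
  koszulParity_inclS BV s

lemma koszul_isOdd_oddGen (v : V) : (koszul e ξ BV).IsOdd (oddGen BV v) := by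
  change koszulParity BV _ = _
  simp only [koszulParity, oddGen_apply, Algebra.TensorProduct.map_tmul, map_one,
    CliffordAlgebra.involute_ι]
  exact TensorProduct.tmul_neg _ _

lemma koszul_d_oddGen (v : V) : (koszul e ξ BV).d (oddGen BV v) =
    evenGen BV v - algebraMap k _ (evalAt e ξ (SymmetricAlgebra.ι k V v)) := by
  have h : (koszul e ξ BV).d ∘ₗ oddGen BV = evenGen BV - Algebra.linearMap k _ ∘ₗ
      (evalAt e ξ).toLinearMap ∘ₗ SymmetricAlgebra.ι k V := by
    refine e.ext fun a => ?_
    simp only [LinearMap.comp_apply, LinearMap.sub_apply, AlgHom.toLinearMap_apply,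
      evalAt_ι_basis, Algebra.linearMap_apply]
    exact koszulD_one_tmul_basis e ξ BV a
  exact LinearMap.congr_fun h v

lemma koszul_d_inclS_mul (s : SymmetricAlgebra k V) (x : KoszulAlgebra BV) :
    (koszul e ξ BV).d (inclS BV s * x) = inclS BV s * (koszul e ξ BV).d x := by
  rw [(koszul e ξ BV).leibniz, koszul_d_inclS, zero_mul, zero_add, koszul_parity_inclS]

lemma koszul_d_evenGen_mul (v : V) (x : KoszulAlgebra BV) :
    (koszul e ξ BV).d (evenGen BV v * x) = evenGen BV v * (koszul e ξ BV).d x :=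
  koszul_d_inclS_mul e ξ BV _ x

lemma koszul_d_oddGen_mul (v : V) (x : KoszulAlgebra BV) :
    (koszul e ξ BV).d (oddGen BV v * x) =
      evenGen BV v * x - evalAt e ξ (SymmetricAlgebra.ι k V v) • x
        - oddGen BV v * (koszul e ξ BV).d x := by
  rw [(koszul_isOdd_oddGen e ξ BV v).d_mul, koszul_d_oddGen, sub_mul, ← Algebra.smul_def]

/-- The Koszul homotopy of `K(V, B_V)`. -/
def koszulHomotopyData : KoszulHomotopy k (KoszulAlgebra BV) V ι where
  even := evenGen BV
  odd := oddGen BV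
  d := (koszul e ξ BV).d
  h := koszulHomotopy e BV
  pderiv := koszulPartial e BV
  value v := evalAt e ξ (SymmetricAlgebra.ι k V v)
  coord a v := e.repr v a
  polar a v := BV (e a) v + BV v (e a)
  d_d := (koszul e ξ BV).d_d
  d_one := (koszul e ξ BV).d_one
  h_one := koszulHomotopy_one e BV
  pderiv_one := koszulPartial_one e BV
  d_even := koszul_d_evenGen_mul e ξ BV
  d_odd := koszul_d_oddGen_mul e ξ BV
  pderiv_even := koszulPartial_evenGen_mul e BV
  pderiv_odd := koszulPartial_oddGen_mul e BV
  h_even := koszulHomotopy_evenGen_mul e BV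
  h_odd := koszulHomotopy_oddGen_mul e BV

/-- Every cocycle of `K(V, B_V)` is a scalar up to a coboundary. -/
theorem exists_eq_algebraMap_add_koszul_d {x : KoszulAlgebra BV} (hx : (koszul e ξ BV).d x = 0) :
    ∃ c z, x = algebraMap k _ c + (koszul e ξ BV).d z :=
  (koszulHomotopyData e ξ BV).exists_eq_algebraMap_add_d (adjoin_evenGen_union_oddGen BV) hx

end Acyclic

/-! ### Cohomology after dividing by a transgressive regular element -/

section CohomologyModel

variable {k A E : Type*} [CommRing k] [Ring A] [Algebra k A] [AddCommGroup E] [Module k E]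

/-- The linear map `u` identifies `E` with the cohomology of the quotient of `A` by `I`. -/
structure IsCohomologyModel (D : SuperDifferential k A) (I : Ideal A) (u : E →ₗ[k] A) : Prop where
  d_mem : ∀ a, D.d (u a) ∈ I
  exists_sub_mem : ∀ x, D.d x ∈ I → ∃ a y, x - u a - D.d y ∈ I
  eq_zero : ∀ a y, u a - D.d y ∈ I → a = 0

/-- Let `q = d C` be central and a nonzerodivisor modulo `I`. Then the cohomology of the quotient
by `I + (q)` is `H ⊕ C H`, where `H` is the cohomology of the quotient by `I`. -/
lemma IsCohomologyModel.extend {D : SuperDifferential k A} {I I' : Ideal A} [I.IsTwoSided]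
    {u : E →ₗ[k] A} (hu : IsCohomologyModel D I u) (hI : ∀ x ∈ I, D.d x ∈ I) {q C : A}
    (hC : D.IsOdd C) (hdC : D.d C = q) (hq : ∀ x, q * x = x * q)
    (hreg : ∀ x, q * x ∈ I → x ∈ I) (hI' : ∀ x, x ∈ I' ↔ ∃ y, x - q * y ∈ I) :
    IsCohomologyModel D I' (u ∘ₗ LinearMap.fst k E E +
      LinearMap.mulLeft k C ∘ₗ u ∘ₗ LinearMap.snd k E E) := by
  have hdq : D.d q = 0 := by rw [← hdC, D.d_d]
  have hdqm : ∀ y, D.d (q * y) = q * D.d y := by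
    intro y
    rw [hq, D.leibniz, hdq, mul_zero, add_zero, hq]
  have hdCm : ∀ y, D.d (C * y) = q * y - C * D.d y := fun y => by rw [hC.d_mul, hdC]
  have hle : ∀ x ∈ I, x ∈ I' := fun x hx => (hI' x).2 ⟨0, by simpa using hx⟩
  have hCI : ∀ x ∈ I, C * x ∈ I := fun x hx => I.mul_mem_left C hx
  have hqI : ∀ x ∈ I, q * x ∈ I := fun x hx => I.mul_mem_left q hx
  constructor
  · rintro ⟨a, b⟩
    refine (hI' _).2 ⟨u b, ?_⟩
    have h : D.d (u a + C * u b) - q * u b = D.d (u a) - C * D.d (u b) := by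
      rw [map_add, hdCm]; abel
    exact h ▸ sub_mem (hu.d_mem a) (hCI _ (hu.d_mem b))
  · intro x hx
    obtain ⟨y, hy⟩ := (hI' _).1 hx
    -- Applying d to d x ≡ q y gives q d y ∈ I, so regularity makes y a cocycle modulo I. Its class
    -- b is the coefficient of C in the class of x.
    have hdy : D.d y ∈ I := by
      refine hreg _ ?_
      have := hI _ hy
      rw [map_sub, D.d_d, hdqm, zero_sub] at this
      exact neg_mem_iff.1 this
    obtain ⟨b, z, hz⟩ := hu.exists_sub_mem y hdy
    obtain ⟨a, w, hw⟩ := hu.exists_sub_mem (x - C * u b - q * z) (by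
      have h : D.d (x - C * u b - q * z) =
          D.d x - q * y + q * (y - u b - D.d z) + C * D.d (u b) := by
        rw [map_sub, map_sub, hdCm, hdqm, mul_sub, mul_sub]; abel
      rw [h]
      exact add_mem (add_mem hy (hqI _ hz)) (hCI _ (hu.d_mem b)))
    refine ⟨(a, b), w, (hI' _).2 ⟨z, ?_⟩⟩
    convert hw using 1
    change x - (u a + C * u b) - D.d w - q * z = _
    abel
  · rintro ⟨a, b⟩ y h
    obtain ⟨z, hz⟩ := (hI' _).1 h
    replace hz : u a + C * u b - D.d y - q * z ∈ I := hz
    -- Applying d to the relation leaves q (u b − d z) modulo I, and q can be cancelled.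
    have hb : b = 0 := by
      refine hu.eq_zero b z (hreg _ ?_)
      have h1 := hI _ hz
      have h2 : q * (u b - D.d z) = D.d (u a + C * u b - D.d y - q * z)
          - D.d (u a) + C * D.d (u b) := by
        rw [map_sub, map_sub, map_add, hdCm, D.d_d, hdqm, mul_sub]; abel
      rw [h2]
      exact add_mem (sub_mem h1 (hu.d_mem a)) (hCI _ (hu.d_mem b))
    subst hb
    rw [map_zero, mul_zero, add_zero] at hz
    have hdz : D.d z ∈ I := by
      refine hreg _ ?_
      have h1 := hI _ hz
      rw [map_sub, map_sub, D.d_d, hdqm, sub_zero] at h1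
      have h2 := sub_mem (hu.d_mem a) h1
      rwa [sub_sub_cancel] at h2
    obtain ⟨c, w, hw⟩ := hu.exists_sub_mem z hdz
    have ha : a = 0 := by
      -- Since z ≡ u c + d w, the term q z equals d (C u c + q w) modulo I and is absorbed into the
      -- coboundary.
      refine hu.eq_zero a (y + C * u c + q * w) ?_
      have h : u a - D.d (y + C * u c + q * w) =
          u a - D.d y - q * z + q * (z - u c - D.d w) + C * D.d (u c) := by
        rw [map_add, map_add, hdCm, hdqm, mul_sub, mul_sub]; abel
      rw [h]
      exact add_mem (add_mem hz (hqI _ hw)) (hCI _ (hu.d_mem c))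
    rw [ha]
    rfl

lemma IsCohomologyModel.comp_equiv {E' : Type*} [AddCommGroup E'] [Module k E'] {u : E →ₗ[k] A}
    {D : SuperDifferential k A} {I : Ideal A} (hu : IsCohomologyModel D I u) (f : E' ≃ₗ[k] E) :
    IsCohomologyModel D I (u ∘ₗ f.toLinearMap) where
  d_mem a := hu.d_mem (f a)
  exists_sub_mem x hx := by
    obtain ⟨a, y, h⟩ := hu.exists_sub_mem x hx
    exact ⟨f.symm a, y, by simpa using h⟩
  eq_zero a y h := by simpa using hu.eq_zero (f a) y h

end CohomologyModel

/-! ### Regularity of translated variables in a polynomial ring -/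

section PolynomialRegularity

open MvPolynomial

variable {k σ : Type*} [Field k]

/-- An ideal generated by variables is tested monomial by monomial, and multiplying a monomial by
X_j does not affect its divisibility by X_i for i ≠ j. -/
lemma mem_span_X_of_X_mul_mem {s : Set σ} {j : σ} (hj : j ∉ s) {G : MvPolynomial σ k}
    (h : X j * G ∈ Ideal.span (X '' s : Set (MvPolynomial σ k))) :
    G ∈ Ideal.span (X '' s : Set (MvPolynomial σ k)) := by
  classical
  rw [mem_ideal_span_X_image] at h ⊢
  intro m hm
  obtain ⟨i, hi, hmi⟩ := h (Finsupp.single j 1 + m) (by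
    rw [MvPolynomial.mem_support_iff] at hm ⊢
    rwa [coeff_X_mul])
  refine ⟨i, hi, ?_⟩
  have hij : i ≠ j := fun h => hj (h ▸ hi)
  simpa [Finsupp.single_eq_of_ne hij] using hmi

lemma mem_span_X_sub_C_of_mul_mem (c : σ → k) {s : Set σ} {j : σ} (hj : j ∉ s)
    {G : MvPolynomial σ k}
    (h : (X j - C (c j)) * G ∈
      Ideal.span ((fun i => X i - C (c i)) '' s : Set (MvPolynomial σ k))) :
    G ∈ Ideal.span ((fun i => X i - C (c i)) '' s : Set (MvPolynomial σ k)) := by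
  let τ : MvPolynomial σ k →ₐ[k] MvPolynomial σ k := aeval fun i => X i + C (c i)
  let τ' : MvPolynomial σ k →ₐ[k] MvPolynomial σ k := aeval fun i => X i - C (c i)
  have hττ : ∀ x, τ' (τ x) = x := by
    intro x
    have : τ'.comp τ = AlgHom.id k _ := by
      ext i
      simp [τ, τ', ← algebraMap_eq]
    exact DFunLike.congr_fun this x
  have h1 := Ideal.mem_map_of_mem τ h
  rw [Ideal.map_span, ← Set.image_comp] at h1
  have h2 : ∀ i, τ (X i - C (c i)) = X i := by
    intro i
    simp [τ, ← algebraMap_eq]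
  simp only [Function.comp_def, h2, map_mul] at h1
  have h3 := Ideal.mem_map_of_mem τ' (mem_span_X_of_X_mul_mem hj h1)
  rw [Ideal.map_span, ← Set.image_comp, hττ] at h3
  simpa only [Function.comp_def, τ', aeval_X] using h3

end PolynomialRegularity

/-! ### Regular sequences of invariants via divided differences -/

section ReflectionRegularity

variable {k V : Type*} [Field k] [AddCommGroup V] [Module k V]

/-- The action of a linear automorphism on the symmetric algebra. -/
abbrev symAct (g : V ≃ₗ[k] V) : SymmetricAlgebra k V →ₐ[k] SymmetricAlgebra k V :=
  SymmetricAlgebra.lift (SymmetricAlgebra.ι k V ∘ₗ g.toLinearMap)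

lemma symAct_mul (g h : V ≃ₗ[k] V) (f : SymmetricAlgebra k V) :
    symAct (g * h) f = symAct g (symAct h f) := by
  have : symAct (g * h) = (symAct g).comp (symAct h) := by
    apply SymmetricAlgebra.algHom_ext
    ext v
    simp
  rw [this]
  rfl

lemma symAct_one (f : SymmetricAlgebra k V) : symAct (1 : V ≃ₗ[k] V) f = f := by
  have : symAct (1 : V ≃ₗ[k] V) = AlgHom.id k _ := by
    apply SymmetricAlgebra.algHom_ext
    ext v
    simp
  rw [this]
  rfl

lemma mem_invariants {W : Subgroup (V ≃ₗ[k] V)} {f : SymmetricAlgebra k V} :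
    f ∈ invariants W ↔ ∀ g ∈ W, symAct g f = f := by
  simp [invariants, Algebra.mem_iInf, AlgHom.mem_equalizer]

/-- The polynomials of degree at most one. -/
def degreeLEOne (k V : Type*) [Field k] [AddCommGroup V] [Module k V] :
    Submodule k (SymmetricAlgebra k V) :=
  1 ⊔ LinearMap.range (SymmetricAlgebra.ι k V)

lemma exists_mem_degreeLEOne_pow (f : SymmetricAlgebra k V) : ∃ n : ℕ, f ∈ degreeLEOne k V ^ n := by
  refine exists_mem_pow_of_adjoin_eq_top le_sup_left ?_ f
  rw [eq_top_iff]
  rintro x -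
  induction x using SymmetricAlgebra.induction with
  | algebraMap c => exact Subalgebra.algebraMap_mem _ c
  | ι v => exact Algebra.subset_adjoin (Submodule.mem_sup_right ⟨v, rfl⟩)
  | mul a b ha hb => exact mul_mem ha hb
  | add a b ha hb => exact add_mem ha hb

lemma symAct_mem_degreeLEOne_pow (g : V ≃ₗ[k] V) {n : ℕ} {f : SymmetricAlgebra k V}
    (hf : f ∈ degreeLEOne k V ^ n) : symAct g f ∈ degreeLEOne k V ^ n := by
  induction hf using Submodule.pow_induction_on_left' with
  | algebraMap c => rw [AlgHom.commutes, pow_zero]; exact Submodule.algebraMap_mem c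
  | add x y i _ _ hx hy => rw [map_add]; exact add_mem hx hy
  | mem_mul m hm i x _ ih =>
    rw [map_mul, Nat.succ_eq_add_one, pow_succ']
    refine Submodule.mul_mem_mul ?_ ih
    obtain ⟨a, ha, b, ⟨v, rfl⟩, rfl⟩ := Submodule.mem_sup.1 hm
    obtain ⟨c, rfl⟩ := Submodule.mem_one.1 ha
    rw [map_add, AlgHom.commutes, SymmetricAlgebra.lift_ι_apply]
    exact add_mem (Submodule.mem_sup_left ha) (Submodule.mem_sup_right ⟨g v, rfl⟩)

/-- The divided differences of a reflection lower the degree. -/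
lemma exists_symAct_sub_eq_mul {g : V ≃ₗ[k] V} {α : V} (hα : ∀ v, ∃ c : k, g v - v = c • α)
    {n : ℕ} {f : SymmetricAlgebra k V} (hf : f ∈ degreeLEOne k V ^ n) :
    ∃ h ∈ degreeLEOne k V ^ (n - 1), (n = 0 → h = 0) ∧
      symAct g f - f = SymmetricAlgebra.ι k V α * h := by
  induction hf using Submodule.pow_induction_on_left' with
  | algebraMap c => exact ⟨0, zero_mem _, fun _ => rfl, by rw [AlgHom.commutes]; simp⟩
  | add x y i _ _ hx hy =>
    obtain ⟨a, ha, ha0, hxa⟩ := hx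
    obtain ⟨b, hb, hb0, hyb⟩ := hy
    refine ⟨a + b, add_mem ha hb, fun h => by rw [ha0 h, hb0 h, add_zero], ?_⟩
    rw [map_add, mul_add, ← hxa, ← hyb]
    ring
  | mem_mul m hm i x hx ih =>
    obtain ⟨h, hh, hh0, hxh⟩ := ih
    have hm' := hm
    obtain ⟨a, ha, b, ⟨v, rfl⟩, rfl⟩ := Submodule.mem_sup.1 hm
    obtain ⟨c, rfl⟩ := Submodule.mem_one.1 ha
    obtain ⟨r, hr⟩ := hα v
    -- Twisted Leibniz rule: g(mx) − mx = (gm − m) gx + m (gx − x), where m = c + v and gm − m = r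
    -- α.
    refine ⟨r • symAct g x + (algebraMap k _ c + SymmetricAlgebra.ι k V v) * h,
      ?_, fun h => absurd h (Nat.succ_ne_zero i), ?_⟩
    · rw [Nat.succ_eq_add_one, Nat.add_sub_cancel]
      refine add_mem (Submodule.smul_mem _ _ (symAct_mem_degreeLEOne_pow g hx)) ?_
      rcases i with _ | i
      · rw [hh0 rfl, mul_zero]; exact zero_mem _
      · rw [pow_succ']; exact Submodule.mul_mem_mul hm' hh
    · have h1 : symAct g (SymmetricAlgebra.ι k V v) =
          SymmetricAlgebra.ι k V v + r • SymmetricAlgebra.ι k V α := by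
        rw [SymmetricAlgebra.lift_ι_apply, ← map_smul, ← map_add, ← hr]
        simp
      rw [map_mul, map_add, AlgHom.commutes, h1]
      rw [sub_eq_iff_eq_add] at hxh
      rw [hxh, Algebra.smul_def, Algebra.smul_def]
      ring

lemma IsReflection.exists_root {g : V ≃ₗ[k] V} (hg : IsReflection g) :
    ∃ α : V, α ≠ 0 ∧ ∀ v, ∃ c : k, g v - v = c • α := by
  obtain ⟨⟨α, hα⟩, h0, h⟩ := finrank_eq_one_iff'.1 hg
  refine ⟨α, fun h' => h0 (Subtype.ext h'), fun v => ?_⟩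
  obtain ⟨c, hc⟩ := h ⟨g v - v, v, rfl⟩
  exact ⟨c, (congrArg Subtype.val hc).symm⟩

variable {W : Subgroup (V ≃ₗ[k] V)} {Q : Set (SymmetricAlgebra k V)} {q : SymmetricAlgebra k V}

lemma symAct_mem_span (hQ : Q ⊆ invariants W) {g : V ≃ₗ[k] V} (hg : g ∈ W)
    {f : SymmetricAlgebra k V} (hf : f ∈ Ideal.span Q) : symAct g f ∈ Ideal.span Q := by
  induction hf using Submodule.span_induction with
  | mem x hx => rw [mem_invariants.1 (hQ hx) g hg]; exact Ideal.subset_span hx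
  | zero => rw [map_zero]; exact zero_mem _
  | add x y _ _ hx hy => rw [map_add]; exact add_mem hx hy
  | smul c x _ hx => rw [smul_eq_mul, map_mul]; exact Ideal.mul_mem_left _ _ hx

/-- If `g` is a reflection, `q f ∈ ⟨Q⟩` with `q`, `Q` invariant, then `q Δ f ∈ ⟨Q⟩` for the divided
difference `Δ f`. -/
lemma mul_mem_span_of_symAct_sub_eq (hQ : Q ⊆ invariants W) (hq : q ∈ invariants W)
    {g : V ≃ₗ[k] V} (hg : g ∈ W) {α : V} (hα0 : α ≠ 0)
    (hα : ∀ v, ∃ c : k, g v - v = c • α) {f h : SymmetricAlgebra k V}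
    (hf : q * f ∈ Ideal.span Q) (hfh : symAct g f - f = SymmetricAlgebra.ι k V α * h) :
    q * h ∈ Ideal.span Q := by
  -- The factor c absorbs the coefficients of an element of the ideal, so that the induction only
  -- meets the invariant generators x, where g(cx) − cx = (gc − c) x.
  have hdiff : ∀ x ∈ Ideal.span Q, ∀ c, ∃ y ∈ Ideal.span Q,
      symAct g (c * x) - c * x = SymmetricAlgebra.ι k V α * y := by
    intro x hx
    induction hx using Submodule.span_induction with
    | mem x hx =>
      intro c
      obtain ⟨n, hn⟩ := exists_mem_degreeLEOne_pow c
      obtain ⟨b, -, -, hb⟩ := exists_symAct_sub_eq_mul hα hn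
      refine ⟨b * x, Ideal.mul_mem_left _ _ (Ideal.subset_span hx), ?_⟩
      rw [map_mul, mem_invariants.1 (hQ hx) g hg, ← sub_mul, hb, mul_assoc]
    | zero => exact fun c => ⟨0, zero_mem _, by simp⟩
    | add x y _ _ hx hy =>
      intro c
      obtain ⟨a, ha, hxa⟩ := hx c
      obtain ⟨b, hb, hyb⟩ := hy c
      refine ⟨a + b, add_mem ha hb, ?_⟩
      rw [mul_add, mul_add, map_add, ← hxa, ← hyb]
      ring
    | smul a x _ hx =>
      intro c
      obtain ⟨y, hy, hxy⟩ := hx (c * a)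
      exact ⟨y, hy, by rw [smul_eq_mul, ← mul_assoc, hxy]⟩
  obtain ⟨y, hy, hxy⟩ := hdiff _ hf 1
  have hι : SymmetricAlgebra.ι k V α ≠ 0 := by
    intro h0
    refine hα0 ((forall_dual_apply_eq_zero_iff k α).1 fun φ => ?_)
    rw [← SymmetricAlgebra.lift_ι_apply φ α, h0, map_zero]
  have hqh : q * h = y := by
    refine mul_left_cancel₀ hι ?_
    rw [← hxy, one_mul, map_mul, mem_invariants.1 hq g hg, ← mul_sub, hfh]
    ring
  rw [hqh]
  exact hy

/-- For a group generated by reflections, `q f ∈ ⟨Q⟩` with `q`, `Q` invariant implies that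
`f` is invariant modulo `⟨Q⟩`. -/
lemma symAct_sub_mem_span (hgen : Subgroup.closure {g | g ∈ W ∧ IsReflection g} = W)
    (hQ : Q ⊆ invariants W) (hq : q ∈ invariants W)
    (hR : ∀ f, q * f ∈ Ideal.span Q → (∀ g ∈ W, symAct g f - f ∈ Ideal.span Q) →
      f ∈ Ideal.span Q)
    {f : SymmetricAlgebra k V} (hf : q * f ∈ Ideal.span Q) : f ∈ Ideal.span Q := by
  obtain ⟨n, hn⟩ := exists_mem_degreeLEOne_pow f
  induction n using Nat.strong_induction_on generalizing f with
  | _ n ih =>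
  -- As ⟨Q⟩ is stable under the group, invariance of f modulo ⟨Q⟩ is needed for reflections only.
  -- There g f − f is a multiple of the divided difference, to which the induction on degree
  -- applies.
  refine hR f hf fun g hg => ?_
  rw [← hgen] at hg
  induction hg using Subgroup.closure_induction with
  | mem g hg =>
    obtain ⟨α, hα0, hα⟩ := hg.2.exists_root
    obtain ⟨h, hh, hh0, hfh⟩ := exists_symAct_sub_eq_mul hα hn
    rw [hfh]
    refine Ideal.mul_mem_left _ _ ?_
    rcases n with _ | n
    · rw [hh0 rfl]; exact zero_mem _
    · exact ih n n.lt_succ_self (mul_mem_span_of_symAct_sub_eq hQ hq hg.1 hα0 hα hf hfh) hh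
  | one => rw [symAct_one, sub_self]; exact zero_mem _
  | mul x y hx hy hxf hyf =>
    rw [hgen] at hx
    rw [symAct_mul, ← sub_add_sub_cancel _ (symAct x f), ← map_sub]
    exact add_mem (symAct_mem_span hQ hx hyf) hxf
  | inv x hx hxf =>
    rw [hgen] at hx
    have h := symAct_mem_span hQ (inv_mem hx) hxf
    rw [map_sub, ← symAct_mul, inv_mul_cancel, symAct_one] at h
    rw [← neg_sub]
    exact neg_mem h

/-- Averaging maps the ideal generated by invariants `Q` to the span of `Q` over the ring of
invariants. -/
lemma sum_symAct_mem_span [Fintype W] (hQ : Q ⊆ invariants W)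
    {f : SymmetricAlgebra k V} (hf : f ∈ Ideal.span Q) :
    ∑ w : W, symAct (w : V ≃ₗ[k] V) f ∈ Submodule.span (invariants W) Q := by
  suffices h : ∀ c, ∑ w : W, symAct (w : V ≃ₗ[k] V) (c * f) ∈ Submodule.span (invariants W) Q by
    simpa only [one_mul] using h 1
  induction hf using Submodule.span_induction with
  | mem x hx =>
    intro c
    have hinv : ∑ w : W, symAct (w : V ≃ₗ[k] V) c ∈ invariants W := by
      refine mem_invariants.2 fun g hg => ?_
      rw [map_sum]
      refine Fintype.sum_equiv (Equiv.mulLeft (⟨g, hg⟩ : W)) _ _ fun w => ?_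
      rw [← symAct_mul]
      rfl
    have h : ∑ w : W, symAct (w : V ≃ₗ[k] V) (c * x) =
        (⟨_, hinv⟩ : invariants W) • x := by
      rw [Subalgebra.smul_def, smul_eq_mul, Finset.sum_mul]
      exact Finset.sum_congr rfl fun w _ => by
        rw [map_mul, mem_invariants.1 (hQ hx) w w.2]
    rw [h]
    exact Submodule.smul_mem _ _ (Submodule.subset_span hx)
  | zero => intro c; simp
  | add x y _ _ hx hy =>
    intro c
    simp only [mul_add, map_add, Finset.sum_add_distrib]
    exact add_mem (hx c) (hy c)
  | smul a x _ hx =>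
    intro c
    simpa only [smul_eq_mul, mul_assoc] using hx (c * a)

/-- An invariant which is regular modulo invariants `Q` on the ring of invariants of a finite
reflection group is so on the whole symmetric algebra. -/
theorem mem_span_of_mul_mem_span [CharZero k] (hW : IsFiniteReflectionGroup W)
    (hQ : Q ⊆ invariants W) (hq : q ∈ invariants W)
    (hR : ∀ f ∈ invariants W, q * f ∈ Submodule.span (invariants W) Q →
      f ∈ Submodule.span (invariants W) Q)
    {f : SymmetricAlgebra k V} (hf : q * f ∈ Ideal.span Q) : f ∈ Ideal.span Q := by
  have := hW.1
  have := Fintype.ofFinite W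
  refine symAct_sub_mem_span hW.2 hQ hq (fun f hf hinv => ?_) hf
  have h1 : ∑ w : W, symAct (w : V ≃ₗ[k] V) f ∈ Submodule.span (invariants W) Q := by
    refine hR _ ?_ ?_
    · refine mem_invariants.2 fun g hg => ?_
      rw [map_sum]
      refine Fintype.sum_equiv (Equiv.mulLeft (⟨g, hg⟩ : W)) _ _ fun w => ?_
      rw [← symAct_mul]
      rfl
    · rw [Finset.mul_sum]
      convert sum_symAct_mem_span hQ hf using 2 with w
      rw [map_mul, mem_invariants.1 hq w w.2]
  have h2 : ∑ w : W, symAct (w : V ≃ₗ[k] V) f ∈ Ideal.span Q :=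
    Submodule.span_le_restrictScalars (invariants W) (SymmetricAlgebra k V) Q h1
  -- |W| f = ∑ w f − ∑ (w f − f), and both sums lie in the ideal.
  have h3 : (Fintype.card W : k) • f ∈ Ideal.span Q := by
    have h4 := sub_mem h2 (sum_mem (t := Finset.univ) fun (w : W) _ => hinv w w.2)
    rw [← Finset.sum_sub_distrib] at h4
    simp only [sub_sub_cancel, Finset.sum_const, Finset.card_univ] at h4
    rwa [Nat.cast_smul_eq_nsmul]
  have h0 : (Fintype.card W : k) ≠ 0 := Nat.cast_ne_zero.2 Fintype.card_ne_zero
  rw [← inv_smul_smul₀ h0 f, Algebra.smul_def]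
  exact Ideal.mul_mem_left _ _ h3

/-- Translates of algebraically independent generators of the invariants of a finite reflection
group form a regular sequence in the symmetric algebra. -/
theorem mem_span_shift_of_mul_mem [CharZero k] {σ : Type*} (hW : IsFiniteReflectionGroup W)
    {p : σ → SymmetricAlgebra k V} (hp : AlgebraicIndependent k p)
    (hpW : Algebra.adjoin k (Set.range p) = invariants W) (c : σ → k) {s : Set σ} {j : σ}
    (hj : j ∉ s) {f : SymmetricAlgebra k V}
    (hf : (p j - algebraMap k _ (c j)) * f ∈
      Ideal.span ((fun i => p i - algebraMap k _ (c i)) '' s)) :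
    f ∈ Ideal.span ((fun i => p i - algebraMap k _ (c i)) '' s) := by
  have hinv : ∀ i, p i - algebraMap k _ (c i) ∈ invariants W := fun i => by
    rw [← hpW]
    exact sub_mem (Algebra.subset_adjoin ⟨i, rfl⟩) (Subalgebra.algebraMap_mem _ _)
  have haev : ∀ f, f ∈ invariants W ↔ ∃ F : MvPolynomial σ k, MvPolynomial.aeval p F = f := by
    intro f
    rw [← hpW, Algebra.adjoin_range_eq_range_aeval]
    rfl
  have hgen : ∀ i, MvPolynomial.aeval p (MvPolynomial.X i - MvPolynomial.C (c i)) =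
      p i - algebraMap k _ (c i) := fun i => by
    simp [← MvPolynomial.algebraMap_eq]
  -- This identifies the ideal of the invariant ring with an ideal of the polynomial ring, where
  -- algebraic independence lets the question be decided.
  have hspan : ∀ f, f ∈ Submodule.span (invariants W)
      ((fun i => p i - algebraMap k _ (c i)) '' s) ↔
      ∃ F ∈ Ideal.span ((fun i => MvPolynomial.X i - MvPolynomial.C (c i)) '' s :
        Set (MvPolynomial σ k)),
        MvPolynomial.aeval p F = f := by
    intro f
    constructor
    · intro h
      induction h using Submodule.span_induction with
      | mem x hx =>
        obtain ⟨i, hi, rfl⟩ := hx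
        exact ⟨_, Ideal.subset_span ⟨i, hi, rfl⟩, hgen i⟩
      | zero => exact ⟨0, zero_mem _, map_zero _⟩
      | add x y _ _ hx hy =>
        obtain ⟨F, hF, rfl⟩ := hx
        obtain ⟨G, hG, rfl⟩ := hy
        exact ⟨F + G, add_mem hF hG, map_add _ _ _⟩
      | smul a x _ hx =>
        obtain ⟨F, hF, rfl⟩ := hx
        obtain ⟨G, hG⟩ := (haev a).1 a.2
        exact ⟨G * F, Ideal.mul_mem_left _ _ hF, by rw [map_mul, hG]; rfl⟩
    · rintro ⟨F, hF, rfl⟩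
      induction hF using Submodule.span_induction with
      | mem x hx =>
        obtain ⟨i, hi, rfl⟩ := hx
        exact Submodule.subset_span ⟨i, hi, (hgen i).symm⟩
      | zero => rw [map_zero]; exact zero_mem _
      | add x y _ _ hx hy => rw [map_add]; exact add_mem hx hy
      | smul a x _ hx =>
        rw [smul_eq_mul, map_mul]
        exact Submodule.smul_mem _ (⟨_, (haev _).2 ⟨a, rfl⟩⟩ : invariants W) hx
  refine mem_span_of_mul_mem_span hW (by rintro _ ⟨i, -, rfl⟩; exact hinv i) (hinv j)
    (fun f hf hqf => ?_) hf
  obtain ⟨F, rfl⟩ := (haev f).1 hf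
  obtain ⟨G, hG, hGF⟩ := (hspan _).1 hqf
  rw [← hgen, ← map_mul] at hGF
  rw [hp hGF] at hG
  exact (hspan _).2 ⟨F, mem_span_X_sub_C_of_mul_mem c hj hG, rfl⟩

end ReflectionRegularity

/-! ### Ideals generated by scalars in a free algebra -/

section FreeAlgebra

variable {R K κ : Type*} [CommRing R] [Ring K] [Algebra R K]

/-- In an algebra which is free as a module, membership in an ideal generated by scalars is tested
on coordinates. -/
lemma mem_span_algebraMap_image_iff (b : Basis κ R K) {P : Set R} {x : K} :
    x ∈ Ideal.span (algebraMap R K '' P) ↔ ∀ i, b.repr x i ∈ Ideal.span P := by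
  constructor
  · intro hx
    suffices h : ∀ c i, b.repr (c * x) i ∈ Ideal.span P by simpa only [one_mul] using h 1
    induction hx using Submodule.span_induction with
    | mem x hx =>
      obtain ⟨f, hf, rfl⟩ := hx
      intro c i
      rw [← Algebra.commutes, ← Algebra.smul_def, map_smul, Finsupp.smul_apply, smul_eq_mul]
      exact Ideal.mul_mem_right _ _ (Ideal.subset_span hf)
    | zero => intro c i; rw [mul_zero, map_zero]; exact zero_mem _
    | add x y _ _ hx hy =>
      intro c i
      rw [mul_add, map_add]
      exact add_mem (hx c i) (hy c i)
    | smul a x _ hx =>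
      intro c i
      rw [smul_eq_mul, ← mul_assoc]
      exact hx _ i
  · intro h
    rw [← b.linearCombination_repr x, Finsupp.linearCombination_apply]
    refine sum_mem fun i _ => ?_
    have hmap : ∀ f ∈ Ideal.span P, ∀ c, f • c ∈ Ideal.span (algebraMap R K '' P) := by
      intro f hf
      induction hf using Submodule.span_induction with
      | mem f hf =>
        intro c
        rw [Algebra.smul_def, Algebra.commutes]
        exact Ideal.mul_mem_left _ _ (Ideal.subset_span ⟨f, hf, rfl⟩)
      | zero => intro c; rw [zero_smul]; exact zero_mem _
      | add f g _ _ hf hg => intro c; rw [add_smul]; exact add_mem (hf c) (hg c)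
      | smul a f _ hf => intro c; rw [smul_assoc, smul_comm]; exact hf (a • c)
    exact hmap _ (h i) _

lemma mem_span_of_algebraMap_mul_mem [Module.Free R K] {P : Set R} {q : R}
    (hq : ∀ f, q * f ∈ Ideal.span P → f ∈ Ideal.span P) {x : K}
    (hx : algebraMap R K q * x ∈ Ideal.span (algebraMap R K '' P)) :
    x ∈ Ideal.span (algebraMap R K '' P) := by
  let b := Module.Free.chooseBasis R K
  rw [mem_span_algebraMap_image_iff b] at hx ⊢
  intro i
  have h := hx i
  rw [← Algebra.smul_def, map_smul, Finsupp.smul_apply, smul_eq_mul] at h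
  exact hq _ h

end FreeAlgebra

/-! ### Odd elements and cohomology classes of a quotient -/

section Quotient

variable {k A E : Type*} [CommRing k] [Ring A] [Algebra k A] [AddCommGroup E] [Module k E]
  (D : SuperDifferential k A) (I : Ideal A) [I.IsTwoSided] (hd : ∀ x ∈ I, D.d x ∈ I)
  (hp : ∀ x ∈ I, D.parity x ∈ I)

namespace SuperDifferential

variable {D} in
lemma IsOdd.sub {x y : A} (hx : D.IsOdd x) (hy : D.IsOdd y) : D.IsOdd (x - y) := by
  rw [IsOdd] at *
  rw [map_sub, hx, hy]
  abel

variable {D} in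
lemma IsOdd.add {x y : A} (hx : D.IsOdd x) (hy : D.IsOdd y) : D.IsOdd (x + y) := by
  rw [IsOdd] at *
  rw [map_add, hx, hy, neg_add]

variable {D} in
lemma IsOdd.smul {x : A} (hx : D.IsOdd x) (t : k) : D.IsOdd (t • x) := by
  rw [IsOdd] at *
  rw [map_smul, hx, smul_neg]

variable {D} in
lemma IsOdd.even_mul {x y : A} (hx : D.IsOdd x) (hy : D.parity y = y) : D.IsOdd (y * x) := by
  rw [IsOdd, map_mul, hx, hy, mul_neg]

variable {D} in
lemma isOdd_sum {κ : Type*} [Fintype κ] {f : κ → A} (hf : ∀ a, D.IsOdd (f a)) :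
    D.IsOdd (∑ a, f a) := by
  rw [IsOdd, map_sum, ← Finset.sum_neg_distrib]
  exact Finset.sum_congr rfl fun a _ => hf a

variable {D} in
lemma cls_eq_algebraMap {x z : A} {c : k} (h : x ∈ D.cocycles)
    (hx : x = algebraMap k _ c + D.d z) : D.cls x h = algebraMap k _ c := by
  refine Ideal.Quotient.eq.2 ⟨z, ?_⟩
  change _ = x - algebraMap k _ c
  rw [hx, add_sub_cancel_left]

lemma bijective_algebraMap_cohomology (h0 : ∀ c z, D.d z = algebraMap k A c → c = 0)
    (h : ∀ x, D.d x = 0 → ∃ c z, x = algebraMap k A c + D.d z) :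
    Function.Bijective (algebraMap k D.Cohomology) := by
  constructor
  · rw [injective_iff_map_eq_zero]
    intro c hc
    obtain ⟨z, hz⟩ := Ideal.Quotient.eq_zero_iff_mem.1
      (show Ideal.Quotient.mk D.coboundaries (algebraMap k _ c) = 0 from hc)
    exact h0 c z hz
  · intro x
    obtain ⟨⟨x, hx⟩, rfl⟩ := Ideal.Quotient.mk_surjective x
    obtain ⟨c, z, hz⟩ := h x hx
    exact ⟨c, (cls_eq_algebraMap hx hz).symm⟩

variable {I}

lemma mk_mem_cocycles_quotient {x : A} :
    Ideal.Quotient.mk I x ∈ (D.quotient I hd hp).cocycles ↔ D.d x ∈ I :=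
  Ideal.Quotient.eq_zero_iff_mem (I := I) (a := D.d x)

lemma cls_mk_eq_iff {x y : A} (hx : Ideal.Quotient.mk I x ∈ (D.quotient I hd hp).cocycles)
    (hy : Ideal.Quotient.mk I y ∈ (D.quotient I hd hp).cocycles) :
    (D.quotient I hd hp).cls _ hx = (D.quotient I hd hp).cls _ hy ↔ ∃ z, x - y - D.d z ∈ I := by
  rw [Ideal.Quotient.eq]
  constructor
  · rintro ⟨z, hz⟩
    obtain ⟨z, rfl⟩ := Ideal.Quotient.mk_surjective z
    refine ⟨z, ?_⟩
    have h : Ideal.Quotient.mk I (D.d z) = Ideal.Quotient.mk I (x - y) := hz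
    exact Ideal.Quotient.eq.1 h.symm
  · rintro ⟨z, hz⟩
    exact ⟨Ideal.Quotient.mk I z, (Ideal.Quotient.eq.2 hz).symm⟩

lemma exists_cls_mk_eq (c : (D.quotient I hd hp).Cohomology) :
    ∃ x, ∃ hx : Ideal.Quotient.mk I x ∈ (D.quotient I hd hp).cocycles,
      (D.quotient I hd hp).cls _ hx = c := by
  obtain ⟨⟨y, hy⟩, rfl⟩ := Ideal.Quotient.mk_surjective c
  obtain ⟨x, rfl⟩ := Ideal.Quotient.mk_surjective y
  exact ⟨x, hy, rfl⟩

/-- The linear map to the cohomology of a quotient given by a linear family of cocycles. -/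
def toCohomologyQuotient (u : E →ₗ[k] A) (hu : ∀ a, D.d (u a) ∈ I) :
    E →ₗ[k] (D.quotient I hd hp).Cohomology where
  toFun a := (D.quotient I hd hp).cls (Ideal.Quotient.mk I (u a))
    ((D.mk_mem_cocycles_quotient hd hp).2 (hu a))
  map_add' a b := by
    rw [← map_add]
    refine congrArg _ (Subtype.ext ?_)
    change Ideal.Quotient.mk I (u (a + b)) = Ideal.Quotient.mk I (u a) + Ideal.Quotient.mk I (u b)
    rw [map_add, map_add]
  map_smul' c a := by
    have h : (D.quotient I hd hp).cls (Ideal.Quotient.mk I (u (c • a)))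
        ((D.mk_mem_cocycles_quotient hd hp).2 (hu (c • a))) =
        (D.quotient I hd hp).cls (c • Ideal.Quotient.mk I (u a))
          (Subalgebra.smul_mem _ ((D.mk_mem_cocycles_quotient hd hp).2 (hu a)) c) := by
      congr 2
      rw [map_smul]
      rfl
    rw [h]
    rfl

end SuperDifferential

variable {D I}

lemma IsCohomologyModel.bijective {u : E →ₗ[k] A} (hu : IsCohomologyModel D I u) :
    Function.Bijective (D.toCohomologyQuotient hd hp u hu.d_mem) := by
  constructor
  · rw [← LinearMap.ker_eq_bot, LinearMap.ker_eq_bot']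
    intro a ha
    have h0 : Ideal.Quotient.mk I (u 0) ∈ (D.quotient I hd hp).cocycles := by
      rw [map_zero, map_zero]; exact zero_mem _
    have h : (D.quotient I hd hp).cls _ ((D.mk_mem_cocycles_quotient hd hp).2 (hu.d_mem a)) =
        (D.quotient I hd hp).cls _ h0 :=
      ha.trans (map_zero (D.toCohomologyQuotient hd hp u hu.d_mem)).symm
    obtain ⟨z, hz⟩ := (D.cls_mk_eq_iff hd hp _ _).1 h
    rw [map_zero, sub_zero] at hz
    exact hu.eq_zero a z hz
  · intro c
    obtain ⟨x, hx, rfl⟩ := D.exists_cls_mk_eq hd hp c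
    obtain ⟨a, y, hy⟩ := hu.exists_sub_mem x ((D.mk_mem_cocycles_quotient hd hp).1 hx)
    exact ⟨a, ((D.cls_mk_eq_iff hd hp _ _).2 ⟨y, hy⟩).symm⟩

end Quotient

/-! ### Evaluation at `ξ`, transgression and anticommutators -/

section Evaluation

variable {k V ι : Type*} [Field k] [AddCommGroup V] [Module k V]
  (e : Basis ι k V) (ξ : V) (BV : LinearMap.BilinForm k V)

/-- Evaluation at `ξ` of the first factor of `K(V, B_V) = SV ⊗ Cl`. -/
def koszulEval : KoszulAlgebra BV →ₐ[k] Cl BV :=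
  Algebra.TensorProduct.lift ((Algebra.ofId k (Cl BV)).comp (evalAt e ξ)) (AlgHom.id k _)
    fun s x => Algebra.commutes (evalAt e ξ s) x

lemma koszulEval_tmul (s : SymmetricAlgebra k V) (x : Cl BV) :
    koszulEval e ξ BV (s ⊗ₜ x) = evalAt e ξ s • x := by
  rw [Algebra.smul_def]
  rfl

lemma koszulEval_parity (x : KoszulAlgebra BV) :
    koszulEval e ξ BV (koszulParity BV x) = CliffordAlgebra.involute (koszulEval e ξ BV x) := by
  induction x using TensorProduct.induction_on with
  | zero => simp
  | add x y hx hy => simp only [map_add, hx, hy]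
  | tmul s x =>
    rw [koszulParity, Algebra.TensorProduct.map_tmul, koszulEval_tmul, koszulEval_tmul, map_smul]
    rfl

lemma exists_sub_algebraMap_evalAt_eq_sum [Fintype ι] (s : SymmetricAlgebra k V) :
    ∃ f : ι → SymmetricAlgebra k V, s - algebraMap k _ (evalAt e ξ s) =
      ∑ a, f a * (SymmetricAlgebra.ι k V (e a) - algebraMap k _ (e.repr ξ a)) := by
  induction s using SymmetricAlgebra.induction with
  | algebraMap c => exact ⟨0, by simp⟩
  | ι v =>
    refine ⟨fun a => algebraMap k _ (e.repr v a), ?_⟩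
    have h : SymmetricAlgebra.ι k V v =
        ∑ a, algebraMap k _ (e.repr v a) * SymmetricAlgebra.ι k V (e a) := by
      conv_lhs => rw [← e.sum_repr v]
      simp only [map_sum, map_smul, Algebra.smul_def]
    simp only [evalAt_ι, map_sum, mul_sub, Finset.sum_sub_distrib, map_mul, ← h]
  | mul s t hs ht =>
    obtain ⟨f, hf⟩ := hs
    obtain ⟨g, hg⟩ := ht
    refine ⟨fun a => t * f a + algebraMap k _ (evalAt e ξ s) * g a, ?_⟩
    simp only [add_mul, Finset.sum_add_distrib, mul_assoc, ← Finset.mul_sum, ← hf, ← hg, map_mul]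
    ring
  | add s t hs ht =>
    obtain ⟨f, hf⟩ := hs
    obtain ⟨g, hg⟩ := ht
    refine ⟨f + g, ?_⟩
    simp only [Pi.add_apply, add_mul, Finset.sum_add_distrib, ← hf, ← hg, map_add]
    ring

/-- Differentiate the expansion by the Leibniz rule: terms that retain a factor e_a − ξ^a vanish at
ξ. The coefficients f_a are not unique, but their values at ξ are. -/
lemma evalAt_partialDeriv_eq [Fintype ι] {s : SymmetricAlgebra k V} {f : ι → SymmetricAlgebra k V}
    (hf : s - algebraMap k _ (evalAt e ξ s) =
      ∑ a, f a * (SymmetricAlgebra.ι k V (e a) - algebraMap k _ (e.repr ξ a))) (b : ι) :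
    evalAt e ξ (partialDeriv e b s) = evalAt e ξ (f b) := by
  classical
  have h := congrArg (fun x => evalAt e ξ (partialDeriv e b x)) hf
  simp only [map_sub, map_sum, partialDeriv_algebraMap, sub_zero, partialDeriv_mul, map_add,
    map_mul, evalAt_ι_basis, partialDeriv_ι, AlgHom.commutes, Algebra.algebraMap_self,
    RingHom.id_apply, sub_self, mul_zero, add_zero, Basis.repr_self, Finsupp.single_apply] at h
  rw [h]
  simp

variable [Fintype ι] [CharZero k]

/-- Every term of d' carries a factor e_a − ξ^a, which vanishes at ξ. Evaluation therefore reads off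
the scalar class of a cocycle. -/
lemma koszulEval_d (x : KoszulAlgebra BV) : koszulEval e ξ BV ((koszul e ξ BV).d x) = 0 := by
  change koszulEval e ξ BV (koszulD e ξ BV x) = 0
  induction x using TensorProduct.induction_on with
  | zero => simp
  | add x y hx hy => rw [map_add, map_add, hx, hy, add_zero]
  | tmul s x =>
    rw [koszulD_tmul, map_sum]
    refine Finset.sum_eq_zero fun a _ => ?_
    rw [koszulEval_tmul, map_mul, map_sub, evalAt_ι_basis, AlgHom.commutes]
    simp

lemma algebraMap_cl_injective : Function.Injective (algebraMap k (Cl BV)) := by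
  have : Invertible (2 : k) := invertibleOfNonzero two_ne_zero
  exact (algebraMap k (Cl BV)).injective

variable {e ξ BV}

/-- An odd cocycle is a coboundary. -/
lemma exists_koszul_d_eq_of_isOdd {C : KoszulAlgebra BV} (hC : (koszul e ξ BV).IsOdd C)
    (hdC : (koszul e ξ BV).d C = 0) : ∃ y, (koszul e ξ BV).d y = C := by
  obtain ⟨c, z, hz⟩ := exists_eq_algebraMap_add_koszul_d e ξ BV hdC
  have h1 : koszulEval e ξ BV C = algebraMap k _ c := by
    rw [hz, map_add, koszulEval_d, add_zero, AlgHom.commutes]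
  have h2 : koszulEval e ξ BV ((koszul e ξ BV).parity C) = algebraMap k _ c :=
    (koszulEval_parity e ξ BV C).trans (by rw [h1, AlgHom.commutes])
  rw [hC, map_neg, h1, ← map_neg] at h2
  -- The parity fixes the scalar c, while oddness of the cocycle negates it, so c = 0.
  rw [self_eq_neg.1 (algebraMap_cl_injective BV h2).symm, map_zero, zero_add] at hz
  exact ⟨z, hz.symm⟩

variable (e ξ BV)

lemma exists_transgression (s : SymmetricAlgebra k V) :
    ∃ C : KoszulAlgebra BV, (koszul e ξ BV).IsOdd C ∧
      (koszul e ξ BV).d C = inclS BV (s - algebraMap k _ (evalAt e ξ s)) ∧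
      koszulEval e ξ BV C = CliffordAlgebra.ι _ (gradAt e ξ s) := by
  obtain ⟨f, hf⟩ := exists_sub_algebraMap_evalAt_eq_sum e ξ s
  refine ⟨∑ a, inclS BV (f a) * oddGen BV (e a), ?_, ?_, ?_⟩
  · exact SuperDifferential.isOdd_sum fun a =>
      (koszul_isOdd_oddGen e ξ BV (e a)).even_mul (koszul_parity_inclS e ξ BV (f a))
  · rw [hf, map_sum, map_sum]
    refine Finset.sum_congr rfl fun a _ => ?_
    rw [koszul_d_inclS_mul, koszul_d_oddGen, evalAt_ι_basis, map_mul, map_sub, AlgHom.commutes,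
      evenGen_apply]
  · rw [map_sum, gradAt, LinearMap.sum_apply, map_sum]
    refine Finset.sum_congr rfl fun a _ => ?_
    rw [LinearMap.smulRight_apply, map_smul, LinearMap.comp_apply, AlgHom.toLinearMap_apply,
      evalAt_partialDeriv_eq e ξ hf, map_mul, oddGen_apply, koszulEval_tmul, map_one, one_smul,
      Algebra.TensorProduct.includeLeft_apply, koszulEval_tmul, smul_mul_assoc, one_mul]

variable {e ξ BV}

/-- The cochain differs from the explicit one of `exists_transgression` by an odd cocycle, hence by
a coboundary, which evaluation kills. -/
lemma koszulEval_of_d_eq {q : SymmetricAlgebra k V} (hq : evalAt e ξ q = 0) {C : KoszulAlgebra BV}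
    (hC : (koszul e ξ BV).IsOdd C) (hdC : (koszul e ξ BV).d C = inclS BV q) :
    koszulEval e ξ BV C = CliffordAlgebra.ι _ (gradAt e ξ q) := by
  obtain ⟨C₀, hC₀, hdC₀, h⟩ := exists_transgression e ξ BV q
  rw [hq, map_zero, sub_zero] at hdC₀
  obtain ⟨y, hy⟩ := exists_koszul_d_eq_of_isOdd (hC.sub hC₀) (by rw [map_sub, hdC, hdC₀, sub_self])
  have h1 := koszulEval_d e ξ BV y
  rw [hy, map_sub, sub_eq_zero] at h1
  rw [h1, h]

lemma koszul_d_anticommutator {q q' : SymmetricAlgebra k V} {C C' : KoszulAlgebra BV}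
    (hC : (koszul e ξ BV).IsOdd C) (hC' : (koszul e ξ BV).IsOdd C')
    (hdC : (koszul e ξ BV).d C = inclS BV q) (hdC' : (koszul e ξ BV).d C' = inclS BV q') :
    (koszul e ξ BV).d (C * C' + C' * C) = 0 := by
  rw [map_add, hC.d_mul, hC'.d_mul, hdC, hdC', inclS_comm, inclS_comm]
  abel

lemma exists_anticommutator_eq {q q' : SymmetricAlgebra k V} (hq : evalAt e ξ q = 0)
    (hq' : evalAt e ξ q' = 0) {C C' : KoszulAlgebra BV} (hC : (koszul e ξ BV).IsOdd C)
    (hC' : (koszul e ξ BV).IsOdd C') (hdC : (koszul e ξ BV).d C = inclS BV q)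
    (hdC' : (koszul e ξ BV).d C' = inclS BV q') :
    ∃ z, C * C' + C' * C =
      algebraMap k _ (gradForm e ξ BV q q' + gradForm e ξ BV q' q) + (koszul e ξ BV).d z := by
  obtain ⟨c, z, hz⟩ := exists_eq_algebraMap_add_koszul_d e ξ BV
    (koszul_d_anticommutator hC hC' hdC hdC')
  have h := congrArg (koszulEval e ξ BV) hz
  rw [map_add, map_add, map_mul, map_mul, koszulEval_of_d_eq hq hC hdC,
    koszulEval_of_d_eq hq' hC' hdC', CliffordAlgebra.ι_mul_ι_add_swap,
    LinearMap.BilinMap.polar_toQuadraticMap, koszulEval_d, add_zero, AlgHom.commutes] at h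
  refine ⟨z, ?_⟩
  rw [hz, ← algebraMap_cl_injective BV h]
  rfl

variable (e ξ BV)

theorem bijective_algebraMap_koszul_cohomology :
    Function.Bijective (algebraMap k (koszul e ξ BV).Cohomology) := by
  refine (koszul e ξ BV).bijective_algebraMap_cohomology (fun c z hz => ?_)
    fun x hx => exists_eq_algebraMap_add_koszul_d e ξ BV hx
  have h := koszulEval_d e ξ BV z
  rw [hz, AlgHom.commutes] at h
  exact (map_eq_zero_iff _ (algebraMap_cl_injective BV)).1 h

end Evaluation

/-! ### Dimension of Clifford algebras -/

section CliffordDimension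

variable {k M : Type*} [Field k] [CharZero k] [AddCommGroup M] [Module k M] [FiniteDimensional k M]

/-- A linear equivalence of a Clifford algebra with coordinates indexed by finite sets. -/
lemma nonempty_cliffordAlgebra_equiv (Q : QuadraticForm k M) :
    Nonempty (CliffordAlgebra Q ≃ₗ[k] (Finset (Fin (finrank k M)) → k)) := by
  have : Invertible (2 : k) := invertibleOfNonzero two_ne_zero
  exact ⟨(CliffordAlgebra.equivExterior Q).trans
    (finBasis k M).ExteriorAlgebra.equivFun⟩

lemma finiteDimensional_cliffordAlgebra (Q : QuadraticForm k M) :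
    FiniteDimensional k (CliffordAlgebra Q) :=
  (nonempty_cliffordAlgebra_equiv Q).elim fun f => Module.Finite.equiv f.symm

lemma finrank_cliffordAlgebra (Q : QuadraticForm k M) :
    finrank k (CliffordAlgebra Q) = 2 ^ finrank k M := by
  obtain ⟨f⟩ := nonempty_cliffordAlgebra_equiv Q
  rw [f.finrank_eq]
  simp

end CliffordDimension

/-- Halving the anticommutator of a cochain with itself gives the Clifford relation for its square.
-/
lemma SuperDifferential.exists_eq_of_add_self_eq {k A : Type*} [Field k] [CharZero k] [Ring A]
    [Algebra k A] (D : SuperDifferential k A) {x z : A} {t : k}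
    (h : x + x = algebraMap k A (t + t) + D.d z) : ∃ y, x = algebraMap k A t + D.d y := by
  refine ⟨(2 : k)⁻¹ • z, ?_⟩
  have h2 : (2 : k) ≠ 0 := two_ne_zero
  rw [map_add, ← two_smul k, ← two_smul k (algebraMap k A t), ← eq_inv_smul_iff₀ h2, smul_add,
    inv_smul_smul₀ h2] at h
  rw [map_smul, h]

/-! ### Recognizing a Clifford algebra by relations, generation and dimension -/

section CliffordIso

variable {k A M E : Type*} [Field k] [CharZero k] [Ring A] [Algebra k A] [AddCommGroup M]
  [Module k M] [FiniteDimensional k M] [AddCommGroup E] [Module k E] [FiniteDimensional k E]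
  {D : SuperDifferential k A} {I : Ideal A} [I.IsTwoSided] (hd : ∀ x ∈ I, D.d x ∈ I)
  (hp : ∀ x ∈ I, D.parity x ∈ I)

/-- If `c : M → A` satisfies the Clifford relations up to coboundaries, and products of elements of
its range represent all classes in the cohomology of the quotient by `I`, of dimension at least
`2 ^ dim M`, then this cohomology is the Clifford algebra. -/
theorem exists_cliffordAlgebra_equiv_cohomology (Q : QuadraticForm k M) (c : M →ₗ[k] A)
    (hc : ∀ m, D.d (c m) ∈ I) (hQ : ∀ m, ∃ z, c m * c m = algebraMap k A (Q m) + D.d z)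
    {u : E →ₗ[k] A} (hu : IsCohomologyModel D I u)
    (huc : ∀ a, u a ∈ Algebra.adjoin k (Set.range c)) (hdim : 2 ^ finrank k M ≤ finrank k E) :
    ∃ Φ : CliffordAlgebra Q ≃ₐ[k] (D.quotient I hd hp).Cohomology,
      ∀ m, Φ (CliffordAlgebra.ι Q m) = D.toCohomologyQuotient hd hp c hc m := by
  let F := D.quotient I hd hp
  have hsq : ∀ m, D.toCohomologyQuotient hd hp c hc m * D.toCohomologyQuotient hd hp c hc m =
      algebraMap k _ (Q m) := by
    intro m
    obtain ⟨z, hz⟩ := hQ m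
    have h := (D.mk_mem_cocycles_quotient hd hp).2 (hc m)
    refine SuperDifferential.cls_eq_algebraMap (D := F) (z := Ideal.Quotient.mk I z)
      (F.cocycles.mul_mem h h) ?_
    change Ideal.Quotient.mk I (c m * c m) =
      Ideal.Quotient.mk I (algebraMap k A (Q m)) + Ideal.Quotient.mk I (D.d z)
    rw [hz, map_add]
  let φ : CliffordAlgebra Q →ₐ[k] F.Cohomology :=
    CliffordAlgebra.lift Q ⟨D.toCohomologyQuotient hd hp c hc, hsq⟩
  have hφ : ∀ m, φ (CliffordAlgebra.ι Q m) = D.toCohomologyQuotient hd hp c hc m :=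
    fun m => CliffordAlgebra.lift_ι_apply _ _ _
  have hadj : ∀ x ∈ Algebra.adjoin k (Set.range c),
      ∃ h : Ideal.Quotient.mk I x ∈ F.cocycles, F.cls _ h ∈ φ.range := by
    intro x hx
    induction hx using Algebra.adjoin_induction with
    | mem x hx =>
      obtain ⟨m, rfl⟩ := hx
      exact ⟨(D.mk_mem_cocycles_quotient hd hp).2 (hc m), _, hφ m⟩
    | algebraMap r => exact ⟨F.cocycles.algebraMap_mem r, φ.range.algebraMap_mem r⟩
    | add x y _ _ hx hy =>
      obtain ⟨hx, hx'⟩ := hx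
      obtain ⟨hy, hy'⟩ := hy
      exact ⟨F.cocycles.add_mem hx hy, φ.range.add_mem hx' hy'⟩
    | mul x y _ _ hx hy =>
      obtain ⟨hx, hx'⟩ := hx
      obtain ⟨hy, hy'⟩ := hy
      exact ⟨F.cocycles.mul_mem hx hy, φ.range.mul_mem hx' hy'⟩
  have hbij := hu.bijective hd hp
  have hsurj : Function.Surjective φ := by
    intro y
    obtain ⟨a, rfl⟩ := hbij.2 y
    obtain ⟨h, h'⟩ := hadj _ (huc a)
    exact h'
  let f : E ≃ₗ[k] F.Cohomology := LinearEquiv.ofBijective _ hbij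
  have := finiteDimensional_cliffordAlgebra Q
  have : FiniteDimensional k F.Cohomology := Module.Finite.equiv f
  -- Surjectivity bounds the cohomology above by 2 ^ dim M; the model `E` bounds it below.
  have hfin : finrank k (CliffordAlgebra Q) = finrank k F.Cohomology := by
    refine le_antisymm ?_ (LinearMap.finrank_le_finrank_of_surjective
      (f := φ.toLinearMap) hsurj)
    rw [finrank_cliffordAlgebra, ← f.finrank_eq]
    exact hdim
  have hinj : Function.Injective φ :=
    (LinearMap.injective_iff_surjective_of_finrank_eq_finrank (f := φ.toLinearMap) hfin).2 hsurj
  exact ⟨AlgEquiv.ofBijective φ ⟨hinj, hsurj⟩, hφ⟩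

end CliffordIso

/-! ### The ideal generated by elements of `SV` -/

section IdealOf

variable {k V ι : Type*} [Field k] [AddCommGroup V] [Module k V] (e : Basis ι k V) (ξ : V)
  {BV : LinearMap.BilinForm k V}

lemma evalAt_eq_zero_of_mem_span {r : ℕ} {p : Fin r → SymmetricAlgebra k V} {q : SymmetricAlgebra k V}
    (hq : q ∈ Submodule.span k (shiftedGens e ξ p)) : evalAt e ξ q = 0 := by
  have h : Submodule.span k (shiftedGens e ξ p) ≤ LinearMap.ker (evalAt e ξ).toLinearMap := by
    rw [Submodule.span_le]
    rintro _ ⟨i, rfl⟩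
    simp
  exact h hq

/-- `K(V, B_V)` is free over SV, being the base change of a vector space, so regularity in SV passes
to it. -/
lemma mem_idealOf_of_inclS_mul_mem {P : Set (SymmetricAlgebra k V)} {q : SymmetricAlgebra k V}
    (hq : ∀ f, q * f ∈ Ideal.span P → f ∈ Ideal.span P) {x : KoszulAlgebra BV}
    (hx : inclS BV q * x ∈ idealOf BV P) : x ∈ idealOf BV P :=
  mem_span_of_algebraMap_mul_mem hq hx

lemma inclS_mem_idealOf_of_mem_span {P : Set (SymmetricAlgebra k V)} {q : SymmetricAlgebra k V}
    (hq : q ∈ Submodule.span k P) : inclS BV q ∈ idealOf BV P := by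
  induction hq using Submodule.span_induction with
  | mem f hf => exact Ideal.subset_span ⟨f, hf, rfl⟩
  | zero => rw [map_zero]; exact zero_mem _
  | add f g _ _ hf hg => rw [map_add]; exact add_mem hf hg
  | smul c f _ hf =>
    rw [Algebra.smul_def, map_mul]
    exact Ideal.mul_mem_left _ _ hf

lemma mem_idealOf_insert {P : Set (SymmetricAlgebra k V)} {q : SymmetricAlgebra k V}
    {x : KoszulAlgebra BV} :
    x ∈ idealOf BV (insert q P) ↔ ∃ y, x - inclS BV q * y ∈ idealOf BV P := by
  rw [idealOf, Set.image_insert_eq, Ideal.span_insert, Submodule.mem_sup]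
  constructor
  · rintro ⟨a, ha, b, hb, rfl⟩
    obtain ⟨c, rfl⟩ := Ideal.mem_span_singleton'.1 ha
    exact ⟨c, by rw [inclS_comm, add_sub_cancel_left]; exact hb⟩
  · rintro ⟨y, hy⟩
    exact ⟨inclS BV q * y, Ideal.mem_span_singleton'.2 ⟨y, (inclS_comm BV q y).symm⟩, _, hy,
      add_sub_cancel _ _⟩

end IdealOf

/-! ### Cohomology of the quotient by a regular sequence -/

section KoszulQuotient

variable {k V ι : Type*} [Field k] [CharZero k] [AddCommGroup V] [Module k V] [Fintype ι]
  {e : Basis ι k V} {ξ : V} {BV : LinearMap.BilinForm k V}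

lemma koszul_d_mem_idealOf {P : Set (SymmetricAlgebra k V)} {x : KoszulAlgebra BV}
    (hx : x ∈ idealOf BV P) : (koszul e ξ BV).d x ∈ idealOf BV P := by
  induction hx using Submodule.span_induction with
  | mem x hx =>
    obtain ⟨f, -, rfl⟩ := hx
    rw [koszul_d_inclS]
    exact zero_mem _
  | zero => rw [map_zero]; exact zero_mem _
  | add x y _ _ hx hy => rw [map_add]; exact add_mem hx hy
  | smul c x hx' hx =>
    rw [smul_eq_mul, (koszul e ξ BV).leibniz]
    exact add_mem (Ideal.mul_mem_left _ _ hx') (Ideal.mul_mem_left _ _ hx)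

lemma koszul_parity_mem_idealOf {P : Set (SymmetricAlgebra k V)} {x : KoszulAlgebra BV}
    (hx : x ∈ idealOf BV P) : (koszul e ξ BV).parity x ∈ idealOf BV P := by
  induction hx using Submodule.span_induction with
  | mem x hx =>
    obtain ⟨f, hf, rfl⟩ := hx
    rw [koszul_parity_inclS]
    exact Ideal.subset_span ⟨f, hf, rfl⟩
  | zero => rw [map_zero]; exact zero_mem _
  | add x y _ _ hx hy => rw [map_add]; exact add_mem hx hy
  | smul c x _ hx =>
    rw [smul_eq_mul, map_mul]
    exact Ideal.mul_mem_left _ _ hx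

variable (e ξ BV) in
-- Base case of the induction on the length of the regular sequence: nothing has been divided out
-- and the cohomology is k.
lemma isCohomologyModel_koszul : IsCohomologyModel (koszul e ξ BV) (idealOf BV ∅)
    (Algebra.linearMap k (KoszulAlgebra BV)) := by
  have hbot : ∀ x, x ∈ idealOf BV ∅ ↔ x = 0 := fun x => by
    rw [idealOf, Set.image_empty, Ideal.span_empty, Ideal.mem_bot]
  constructor
  · intro c
    rw [hbot, Algebra.linearMap_apply, Algebra.algebraMap_eq_smul_one, map_smul,
      (koszul e ξ BV).d_one, smul_zero]
  · intro x hx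
    obtain ⟨c, z, hz⟩ := exists_eq_algebraMap_add_koszul_d e ξ BV ((hbot _).1 hx)
    exact ⟨c, z, (hbot _).2 (by rw [hz, Algebra.linearMap_apply]; abel)⟩
  · intro c z h
    rw [hbot, sub_eq_zero, Algebra.linearMap_apply] at h
    have h1 := koszulEval_d e ξ BV z
    rw [← h, AlgHom.commutes] at h1
    exact (map_eq_zero_iff _ (algebraMap_cl_injective BV)).1 h1

/-- For a regular sequence `q` with cochains of transgression `C`, the ordered products of the
`C i` represent a basis of the cohomology of the quotient. -/
lemma exists_isCohomologyModel_koszul {r : ℕ} {q : Fin r → SymmetricAlgebra k V}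
    (hq : ∀ (s : Set (Fin r)) (j), j ∉ s → ∀ f, q j * f ∈ Ideal.span (q '' s) →
      f ∈ Ideal.span (q '' s)) {C : Fin r → KoszulAlgebra BV}
    (hC : ∀ i, (koszul e ξ BV).IsOdd (C i)) (hdC : ∀ i, (koszul e ξ BV).d (C i) = inclS BV (q i)) :
    ∃ u : (Fin (2 ^ r) → k) →ₗ[k] KoszulAlgebra BV,
      IsCohomologyModel (koszul e ξ BV) (idealOf BV (Set.range q)) u ∧
      ∀ a, u a ∈ Algebra.adjoin k (Set.range C) := by
  suffices h : ∀ j ≤ r, ∃ u : (Fin (2 ^ j) → k) →ₗ[k] KoszulAlgebra BV,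
      IsCohomologyModel (koszul e ξ BV) (idealOf BV (q '' {i | (i : ℕ) < j})) u ∧
      ∀ a, u a ∈ Algebra.adjoin k (Set.range C) by
    have := h r le_rfl
    simpa only [Fin.is_lt, Set.ofPred_true, Set.image_univ] using this
  intro j hj
  induction j with
  | zero =>
    let f : (Fin (2 ^ 0) → k) ≃ₗ[k] k := LinearEquiv.ofFinrankEq _ _ (by simp)
    refine ⟨_, IsCohomologyModel.comp_equiv (u := Algebra.linearMap k (KoszulAlgebra BV)) ?_ f,
      fun a => Subalgebra.algebraMap_mem _ (f a)⟩
    simpa using isCohomologyModel_koszul e ξ BV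
  | succ j ih =>
    obtain ⟨u, hu, huC⟩ := ih (by omega)
    let i : Fin r := ⟨j, hj⟩
    -- Any linear isomorphism will do: only the dimension of the model and the subalgebra containing
    -- its image matter.
    let f : (Fin (2 ^ (j + 1)) → k) ≃ₗ[k] (Fin (2 ^ j) → k) × (Fin (2 ^ j) → k) :=
      LinearEquiv.ofFinrankEq _ _ (by simp [pow_succ, mul_two])
    have hset : q '' {l : Fin r | (l : ℕ) < j + 1} = insert (q i) (q '' {l | (l : ℕ) < j}) := by
      rw [← Set.image_insert_eq]
      congr 1
      ext l
      simp only [Set.mem_ofPred_eq, Set.mem_insert_iff, Fin.ext_iff, i]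
      omega
    rw [hset]
    refine ⟨_, (hu.extend (fun x hx => koszul_d_mem_idealOf hx) (hC i) (hdC i)
      (inclS_comm BV _) (fun x hx => mem_idealOf_of_inclS_mul_mem
        (hq _ i (by simp [i])) hx) (fun x => mem_idealOf_insert)).comp_equiv f, fun a => ?_⟩
    exact add_mem (huC _) (mul_mem (Algebra.subset_adjoin ⟨i, rfl⟩) (huC _))

end KoszulQuotient

/-! ### Linear choice of cochains of transgression -/

section LinearTransgression

variable {k V ι : Type*} [Field k] [CharZero k] [AddCommGroup V] [Module k V] [Fintype ι]
  (e : Basis ι k V) (ξ : V) (BV : LinearMap.BilinForm k V)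

/-- Cochains of transgression can be chosen linearly. -/
lemma exists_linear_transgression (P : Submodule k (SymmetricAlgebra k V))
    (hP : ∀ q ∈ P, evalAt e ξ q = 0) :
    ∃ c : P →ₗ[k] KoszulAlgebra BV, ∀ q, (koszul e ξ BV).IsOdd (c q) ∧
      (koszul e ξ BV).d (c q) = inclS BV q := by
  -- Pairs (C, q) with C a cochain of transgression for q; over a field the surjective projection to
  -- P has a linear section.
  let O : Submodule k (KoszulAlgebra BV × P) :=
    { carrier := {x | (koszul e ξ BV).IsOdd x.1 ∧ (koszul e ξ BV).d x.1 = inclS BV x.2}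
      zero_mem' := ⟨by simp [SuperDifferential.IsOdd], by simp⟩
      add_mem' := fun {x y} hx hy => ⟨SuperDifferential.IsOdd.add hx.1 hy.1, by
        rw [Prod.fst_add, map_add, hx.2, hy.2, Prod.snd_add, Submodule.coe_add, map_add]⟩
      smul_mem' := fun t x hx => ⟨SuperDifferential.IsOdd.smul hx.1 t, by
        rw [Prod.smul_fst, map_smul, hx.2, Prod.smul_snd, Submodule.coe_smul, map_smul]⟩ }
  have hsurj : LinearMap.range (LinearMap.snd k (KoszulAlgebra BV) P ∘ₗ O.subtype) = ⊤ := by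
    rw [LinearMap.range_eq_top]
    intro q
    obtain ⟨C, hC, hdC, -⟩ := exists_transgression e ξ BV (q : SymmetricAlgebra k V)
    rw [hP q q.2, map_zero, sub_zero] at hdC
    exact ⟨⟨(C, q), hC, hdC⟩, rfl⟩
  obtain ⟨g, hg⟩ := LinearMap.exists_rightInverse_of_surjective _ hsurj
  refine ⟨LinearMap.fst k (KoszulAlgebra BV) P ∘ₗ O.subtype ∘ₗ g, fun q => ?_⟩
  have h := (g q).2
  have hq : (g q : KoszulAlgebra BV × P).2 = q := LinearMap.congr_fun hg q
  refine ⟨h.1, h.2.trans ?_⟩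
  rw [hq]

end LinearTransgression

end Transgression

end

/-! ### The main theorem -/

open Transgression
theorem mainTheorem6 {k V ι : Type*} [Field k] [CharZero k] [AddCommGroup V] [Module k V]
    [Fintype ι] (e : Module.Basis ι k V) (ξ : V) (BV : LinearMap.BilinForm k V) :
    Function.Bijective (algebraMap k (koszul e ξ BV).Cohomology) ∧
    ∀ W : Subgroup (V ≃ₗ[k] V), IsFiniteReflectionGroup W →
    ∀ (r : ℕ) (p : Fin r → SymmetricAlgebra k V),
      (∀ i, ∃ m, IsHomogeneous (p i) m) →
      AlgebraicIndependent k p →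
      Algebra.adjoin k (Set.range p) = invariants W →
      let S := shiftedGens e ξ p
      let P := Submodule.span k S
      let B := (gradForm e ξ BV).restrict P
      let K := koszul e ξ BV
      let F := koszulQuotient e ξ BV S
      (∀ q : P, ∃ C, K.IsOdd C ∧ K.d C = inclS BV q) ∧
      (∀ (q q' : P) (C C' : KoszulAlgebra BV), K.IsOdd C → K.IsOdd C' →
        K.d C = inclS BV q → K.d C' = inclS BV q' →
        ∃ h : C * C' + C' * C ∈ K.cocycles,
          K.cls (C * C' + C' * C) h = algebraMap k K.Cohomology (B q q' + B q' q)) ∧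
      ∃ Φ : Cl B ≃ₐ[k] F.Cohomology,
        ∀ (q : P) (C : KoszulAlgebra BV), K.IsOdd C → K.d C = inclS BV q →
          ∃ h : Ideal.Quotient.mk (idealOf BV S) C ∈ F.cocycles,
            Φ (CliffordAlgebra.ι B.toQuadraticMap q) =
              F.cls (Ideal.Quotient.mk (idealOf BV S) C) h := by
  refine ⟨bijective_algebraMap_koszul_cohomology e ξ BV, fun W hW r p _ hp hpW => ?_⟩
  intro S P B K F
  have hP : ∀ q ∈ P, evalAt e ξ q = 0 := fun q hq => evalAt_eq_zero_of_mem_span e ξ hq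
  obtain ⟨c, hc⟩ := exists_linear_transgression e ξ BV P hP
  have hanti : ∀ (q q' : P) (C C' : KoszulAlgebra BV), K.IsOdd C → K.IsOdd C' →
      K.d C = inclS BV q → K.d C' = inclS BV q' →
      ∃ z, C * C' + C' * C = algebraMap k _ (B q q' + B q' q) + K.d z :=
    fun q q' C C' hC hC' hdC hdC' =>
      exists_anticommutator_eq (hP q q.2) (hP q' q'.2) hC hC' hdC hdC'
  refine ⟨fun q => ⟨c q, hc q⟩, fun q q' C C' hC hC' hdC hdC' => ?_, ?_⟩
  · obtain ⟨z, hz⟩ := hanti q q' C C' hC hC' hdC hdC'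
    exact ⟨koszul_d_anticommutator hC hC' hdC hdC', SuperDifferential.cls_eq_algebraMap _ hz⟩
  let q : Fin r → P := fun i =>
    ⟨p i - algebraMap k _ (evalAt e ξ (p i)), Submodule.subset_span ⟨i, rfl⟩⟩
  obtain ⟨u, hu, huC⟩ := exists_isCohomologyModel_koszul (e := e) (ξ := ξ) (BV := BV)
    (q := fun i => p i - algebraMap k _ (evalAt e ξ (p i)))
    (fun s j hj f hf => mem_span_shift_of_mul_mem hW hp hpW (fun i => evalAt e ξ (p i)) hj hf)
    (C := fun i => c (q i)) (fun i => (hc (q i)).1) (fun i => (hc (q i)).2)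
  have hSfin : S.Finite := Set.finite_range _
  have : FiniteDimensional k P := FiniteDimensional.span_of_finite k hSfin
  -- The upper bound suffices: Cl(P, B) maps onto a space of dimension 2^r.
  have hdim : Module.finrank k P ≤ r := (finrank_range_le_card _).trans_eq (Fintype.card_fin r)
  have hsq : ∀ m, ∃ z, c m * c m = algebraMap k _ (B.toQuadraticMap m) + K.d z := by
    intro m
    obtain ⟨z, hz⟩ := hanti m m _ _ (hc m).1 (hc m).1 (hc m).2 (hc m).2
    exact K.exists_eq_of_add_self_eq hz
  have hcI : ∀ m, K.d (c m) ∈ idealOf BV S := fun m =>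
    (hc m).2 ▸ inclS_mem_idealOf_of_mem_span m.2
  obtain ⟨Φ, hΦ⟩ := exists_cliffordAlgebra_equiv_cohomology (D := K) (I := idealOf BV S)
    (fun x hx => koszul_d_mem_idealOf hx) (fun x hx => koszul_parity_mem_idealOf hx)
    B.toQuadraticMap c hcI hsq hu
    (fun a => Algebra.adjoin_mono (Set.range_comp_subset_range q c) (huC a))
    (by rw [Module.finrank_fin_fun]; exact Nat.pow_le_pow_right two_pos hdim)
  refine ⟨Φ, fun q C hC hdC => ?_⟩
  have hCI : Ideal.Quotient.mk (idealOf BV S) C ∈ F.cocycles :=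
    (K.mk_mem_cocycles_quotient _ _).2 (hdC ▸ inclS_mem_idealOf_of_mem_span q.2)
  -- Independence of the choice: c q − C is an odd cocycle, so it is a coboundary already before
  -- passing to the quotient.
  obtain ⟨y, hy⟩ := exists_koszul_d_eq_of_isOdd (SuperDifferential.IsOdd.sub (hc q).1 hC)
    (by rw [map_sub, (hc q).2, hdC, sub_self])
  refine ⟨hCI, (hΦ q).trans ((K.cls_mk_eq_iff _ _ _ hCI).2 ⟨y, ?_⟩)⟩
  rw [hy, sub_self]
  exact zero_mem _
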